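/- **Theorem 1.1 (Nonexistence of Leray-type self-similar singularities).** Consider in $\mathbb R^3$ the ideal viscoelastic system $$\begin{cases} u_t+(u\cdot\nabla)u=-\nabla p+\sum_{k=1}^3 (F^k\cdot\nabla)F^k,\\ F^k_t+(u\cdot\nabla)F^k=(F^k\cdot\nabla)u,\qquad k=1,2,3,\\ \operatorname{div}u=\operatorname{div}F^k=0,\end{cases}\tag{$*$}$$ for the velocity $u(x,t)\in\mathbb R^3$, the deformation tensor $F(x,t)\in\mathbb R^{3\times3}$ with columns $F^1,F^2,F^3$, and the pressure $p(x,t)\in\mathbb R$. Suppose that there are $T_*>0$ and a classical solution $(u,F,p)$ of $(*)$ on $\mathbb R^3\times(0,T_*)$ (that is, $u,F$ are $C^1$ in $(x,t)$, $p$ is differentiable in $x$, and the equations hold pointwise), with arbitrary initial data, which is represented for all $t\in(0,T_*)$ and $x\in\mathbb R^3$ as $$u(x,t)=\frac{1}{\sqrt{T_*-t}}\,U\!\left(\frac{x}{\sqrt{T_*-t}}\right),\quad F^k(x,t)=\frac{1}{\sqrt{T_*-t}}\,E^k\!\left(\frac{x}{\sqrt{T_*-t}}\right),\quad p(x,t)=\frac{1}{T_*-t}\,P\!\left(\frac{x}{\sqrt{T_*-t}}\right),$$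 where $E=(E^1,E^2,E^3)$, and suppose that 1. $U$ and $E$ belong to $C_0^1(\mathbb R^3)$, i.e. they are continuously differentiable and they and their first derivatives tend to $0$ at infinity; 2. there exists $q>0$ such that $\Omega:=\nabla\times U$ and $E$ belong to $L^r(\mathbb R^3)$ for all $r\in(0,q)$. Then $U=0$ and $E=0$. -/

import Mathlib

open Set Filter Topology MeasureTheory

noncomputable section

namespace Viscoelastic

/-- Three-dimensional Euclidean space. -/
abbrev E3 : Type := EuclideanSpace ℝ (Fin 3)

/-- The partial derivative `∂ⱼ vⁱ` of a vector field on `ℝ³`. -/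
def partialDeriv (v : E3 → E3) (j i : Fin 3) (x : E3) : ℝ :=
  (fderiv ℝ v x (EuclideanSpace.single j 1)) i

/-- The directional derivative `(v · ∇) w` of a vector field. -/
def advect (v w : E3 → E3) (x : E3) : E3 := fderiv ℝ w x (v x)

/-- The divergence of a vector field. -/
def divergence (v : E3 → E3) (x : E3) : ℝ := ∑ i, partialDeriv v i i x

/-- The curl `∇ × v` of a vector field. -/
def curl (v : E3 → E3) (x : E3) : E3 :=
  !₂[partialDeriv v 1 2 x - partialDeriv v 2 1 x,
     partialDeriv v 2 0 x - partialDeriv v 0 2 x,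
     partialDeriv v 0 1 x - partialDeriv v 1 0 x]

/-- The space `C₀¹(ℝ³)`: continuously differentiable fields which, together with their first
derivatives, vanish at infinity. -/
structure IsC10 (f : E3 → E3) : Prop where
  contDiff : ContDiff ℝ 1 f
  tendsto_zero : Tendsto f (cocompact E3) (𝓝 0)
  tendsto_fderiv_zero : Tendsto (fderiv ℝ f) (cocompact E3) (𝓝 0)

/-- `(u, F, p)` is a classical solution on `(0, T) × ℝ³` of the ideal viscoelastic system
`∂ₜu + (u·∇)u = -∇p + ∑ₖ (Fᵏ·∇)Fᵏ`, `∂ₜFᵏ + (u·∇)Fᵏ = (Fᵏ·∇)u`, `div u = div Fᵏ = 0`.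
The matrix field `F` is given by its columns: `F k t x` is the `k`-th column of `F(x,t)`. -/
structure IsClassicalSolution (T : ℝ) (u : ℝ → E3 → E3) (F : Fin 3 → ℝ → E3 → E3)
    (p : ℝ → E3 → ℝ) : Prop where
  contDiffOn_u : ContDiffOn ℝ 1 (fun z : ℝ × E3 => u z.1 z.2) (Ioo 0 T ×ˢ univ)
  contDiffOn_F : ∀ k, ContDiffOn ℝ 1 (fun z : ℝ × E3 => F k z.1 z.2) (Ioo 0 T ×ˢ univ)
  differentiable_p : ∀ t ∈ Ioo 0 T, Differentiable ℝ (p t)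
  momentum : ∀ t ∈ Ioo 0 T, ∀ x,
    deriv (fun s => u s x) t + advect (u t) (u t) x
      = -gradient (p t) x + ∑ k, advect (F k t) (F k t) x
  deformation : ∀ k, ∀ t ∈ Ioo 0 T, ∀ x,
    deriv (fun s => F k s x) t + advect (u t) (F k t) x = advect (F k t) (u t) x
  div_u : ∀ t ∈ Ioo 0 T, ∀ x, divergence (u t) x = 0
  div_F : ∀ k, ∀ t ∈ Ioo 0 T, ∀ x, divergence (F k t) x = 0

/-- `(u, F, p)` has on `(0, T)` the self-similar form with blow-up time `T` and profiles
`(U, E, P)`, where `E k` is the `k`-th column of `E`. -/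
structure IsSelfSimilar (T : ℝ) (u : ℝ → E3 → E3) (F : Fin 3 → ℝ → E3 → E3)
    (p : ℝ → E3 → ℝ) (U : E3 → E3) (E : Fin 3 → E3 → E3) (P : E3 → ℝ) : Prop where
  velocity : ∀ t ∈ Ioo 0 T, ∀ x,
    u t x = (1 / √(T - t)) • U ((1 / √(T - t)) • x)
  deformation : ∀ k, ∀ t ∈ Ioo 0 T, ∀ x,
    F k t x = (1 / √(T - t)) • E k ((1 / √(T - t)) • x)
  pressure : ∀ t ∈ Ioo 0 T, ∀ x,
    p t x = (1 / (T - t)) * P ((1 / √(T - t)) • x)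

end Viscoelastic

end

/-! In self-similar variables the system becomes stationary. With the similarity field `V y = y/2 +
U y`, the profiles satisfy `(V·∇)Eᵏ = (Eᵏ·∇)U - Eᵏ/2` and `(V·∇)U = -U/2 - ∇P + ∑ (Eᵏ·∇)Eᵏ`. Since
`div U = 0`, the field `V` expands volume at the constant rate `div V = 3/2`.

Suppose `|(V·∇)W| ≤ C|W|` with `W` in `L^r` for all small `r`. Testing the equation with `2a
|W|^(2a-2) W` gives `3/2 ∫|W|^(2a) ≤ 2aC ∫|W|^(2a)`. The expansion rate does not depend on `a`,
while the source contributes a factor `a`, so `W = 0` once `a` is small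
(`eq_zero_of_transportDeriv`). Cutoff errors vanish because `V` grows at most linearly and
`|W|^(2a)` is integrable.

This applies first to each `Eᵏ`, the gradient of `U` being bounded. With `E = 0` the pressure is the
only force left, and taking the curl gives `(V·∇)Ω = (Ω·∇)U - Ω`, so the same argument yields `Ω =
0`. But `U` is only `C¹`, so `Ω` is merely continuous and its equation has no classical meaning.
`TransportDeriv` replaces it by limits of mollifications; the commutators with `V·∇` stay bounded
and converge pointwise because `V` is Lipschitz and `C¹` (`transportDeriv_sub`).

Finally `U` is curl-free, divergence-free and decays. A mean value property, again needing only
`C¹`, shows that radial averages of `U` do not depend on the scale. Small scales give a positive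
multiple of `U x`, large scales give `0` (`eq_zero_of_curl_eq_zero`). -/

namespace Viscoelastic

/-! ### Integration by parts against compactly supported functions -/

theorem integral_fderiv_mul_eq_neg {f g : E3 → ℝ} (hf : ContDiff ℝ 1 f) (hg : ContDiff ℝ 1 g)
    (hgc : HasCompactSupport g) (v : E3) :
    ∫ x, fderiv ℝ f x v * g x = -∫ x, f x * fderiv ℝ g x v := by
  have h1 : Continuous fun x => fderiv ℝ f x v := (hf.continuous_fderiv one_ne_zero).clm_apply
    continuous_const
  have h2 : Continuous fun x => fderiv ℝ g x v := (hg.continuous_fderiv one_ne_zero).clm_apply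
    continuous_const
  rw [integral_mul_fderiv_eq_neg_fderiv_mul_of_integrable (μ := volume) (f := f) (g := g) (v := v)
    ((h1.mul hg.continuous).integrable_of_hasCompactSupport hgc.mul_left)
    ((hf.continuous.mul h2).integrable_of_hasCompactSupport (hgc.fderiv_apply ℝ v).mul_left)
    ((hf.continuous.mul hg.continuous).integrable_of_hasCompactSupport hgc.mul_left)
    (fun x _ => hf.differentiable one_ne_zero x) (fun x _ => hg.differentiable one_ne_zero x),
    neg_neg]

theorem contDiff_fderiv_apply {η : E3 → ℝ} (hη : ContDiff ℝ 2 η) (v : E3) :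
    ContDiff ℝ 1 fun x => fderiv ℝ η x v :=
  (hη.fderiv_right (m := 1) (by norm_num)).clm_apply contDiff_const

/-- Weak form of the symmetry of second derivatives. -/
theorem integral_fderiv_mul_fderiv_comm {f η : E3 → ℝ} (hf : ContDiff ℝ 1 f)
    (hη : ContDiff ℝ 2 η) (hηc : HasCompactSupport η) (a b : E3) :
    ∫ x, fderiv ℝ f x a * fderiv ℝ η x b = ∫ x, fderiv ℝ f x b * fderiv ℝ η x a := by
  rw [integral_fderiv_mul_eq_neg hf (contDiff_fderiv_apply hη b) (hηc.fderiv_apply ℝ b),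
    integral_fderiv_mul_eq_neg hf (contDiff_fderiv_apply hη a) (hηc.fderiv_apply ℝ a)]
  congr 2
  ext x
  congr 1
  have hd : DifferentiableAt ℝ (fderiv ℝ η) x :=
    (hη.fderiv_right (m := 1) (by norm_num)).differentiable one_ne_zero x
  have key : ∀ v w : E3, fderiv ℝ (fun x => fderiv ℝ η x v) x w
      = fderiv ℝ (fderiv ℝ η) x w v := by
    intro v w
    rw [fderiv_clm_apply hd (differentiableAt_const v)]
    simp
  rw [key, key]
  exact (hη.contDiffAt.isSymmSndFDerivAt (by simp)) a b

theorem clm_apply_eq_sum {F : Type*} [NormedAddCommGroup F] [NormedSpace ℝ F] (L : E3 →L[ℝ] F)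
    (v : E3) : L v = ∑ k, v k • L (EuclideanSpace.single k 1) := by
  conv_lhs => rw [← (EuclideanSpace.basisFun (Fin 3) ℝ).sum_repr v]
  simp

/-- The `i`-th coordinate functional. -/
noncomputable def coordL (i : Fin 3) : E3 →L[ℝ] ℝ := EuclideanSpace.proj i

theorem fderiv_coord {v : E3 → E3} (hv : ContDiff ℝ 1 v) (i : Fin 3) (x a : E3) :
    fderiv ℝ (fun y => v y i) x a = fderiv ℝ v x a i := by
  have := ((coordL i).hasFDerivAt.comp x (hv.differentiable one_ne_zero x).hasFDerivAt).fderiv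
  have h2 : (fun y => v y i) = coordL i ∘ v := rfl
  rw [h2, this]
  rfl

theorem contDiff_coord {v : E3 → E3} (hv : ContDiff ℝ 1 v) (i : Fin 3) :
    ContDiff ℝ 1 fun y => v y i :=
  (coordL i).contDiff.comp hv

/-- Integrate by parts in each direction `e_k` against `φ V_k` and sum: `div (φ V) = φ div V +
V·∇φ`. -/
theorem integral_mul_fderiv_apply_field {h φ : E3 → ℝ} {V : E3 → E3} (hh : ContDiff ℝ 1 h)
    (hV : ContDiff ℝ 1 V) (hφ : ContDiff ℝ 1 φ) (hφc : HasCompactSupport φ) :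
    ∫ x, φ x * fderiv ℝ h x (V x)
      = -∫ x, h x * (φ x * divergence V x + fderiv ℝ φ x (V x)) := by
  have hg : ∀ k, ContDiff ℝ 1 fun x => φ x * V x k := fun k => hφ.mul (contDiff_coord hV k)
  have hgc : ∀ k, HasCompactSupport fun x => φ x * V x k := fun k => hφc.mul_right
  have hdg : ∀ k x, fderiv ℝ (fun x => φ x * V x k) x (EuclideanSpace.single k 1)
      = φ x * partialDeriv V k k x + V x k * fderiv ℝ φ x (EuclideanSpace.single k 1) := by
    intro k x
    rw [fderiv_fun_mul (hφ.differentiable one_ne_zero x)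
      ((contDiff_coord hV k).differentiable one_ne_zero x)]
    simp only [add_apply, smul_apply, smul_eq_mul,
      fderiv_coord hV, partialDeriv]
  have e1 : ∀ x, φ x * fderiv ℝ h x (V x)
      = ∑ k, fderiv ℝ h x (EuclideanSpace.single k 1) * (φ x * V x k) := by
    intro x
    rw [clm_apply_eq_sum (fderiv ℝ h x), Finset.mul_sum]
    exact Finset.sum_congr rfl fun k _ => by simp only [smul_eq_mul]; ring
  have e2 : ∀ x, h x * (φ x * divergence V x + fderiv ℝ φ x (V x))
      = ∑ k, h x * fderiv ℝ (fun x => φ x * V x k) x (EuclideanSpace.single k 1) := by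
    intro x
    rw [clm_apply_eq_sum (fderiv ℝ φ x), divergence, ← Finset.mul_sum]
    simp only [hdg, Finset.sum_add_distrib, Finset.mul_sum, smul_eq_mul]
  simp only [e1, e2]
  rw [integral_finsetSum, integral_finsetSum, ← Finset.sum_neg_distrib]
  · exact Finset.sum_congr rfl fun k _ => integral_fderiv_mul_eq_neg hh (hg k) (hgc k) _
  · intro k _
    exact (hh.continuous.mul (((hg k).continuous_fderiv one_ne_zero).clm_apply
      continuous_const)).integrable_of_hasCompactSupport ((hgc k).fderiv_apply ℝ _).mul_left
  · intro k _
    exact (((hh.continuous_fderiv one_ne_zero).clm_apply continuous_const).mul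
      (hg k).continuous).integrable_of_hasCompactSupport (hgc k).mul_left

/-! ### Weak transport equations and their renormalization -/

/-- `b` is the derivative of `w` along `V`, in the sense of pointwise limits of uniformly bounded
sequences of `C¹` functions. -/
def TransportDeriv (V : E3 → E3) (w b : E3 → ℝ) : Prop :=
  ∃ (C : ℝ) (wn : ℕ → E3 → ℝ), (∀ n, ContDiff ℝ 1 (wn n)) ∧ (∀ n x, |wn n x| ≤ C) ∧
    (∀ n x, |fderiv ℝ (wn n) x (V x)| ≤ C) ∧
    (∀ x, Tendsto (fun n => wn n x) atTop (𝓝 (w x))) ∧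
    ∀ x, Tendsto (fun n => fderiv ℝ (wn n) x (V x)) atTop (𝓝 (b x))

theorem TransportDeriv.of_contDiff {V : E3 → E3} {w : E3 → ℝ} (hw : ContDiff ℝ 1 w) {C D : ℝ}
    (hC : ∀ x, |w x| ≤ C) (hD : ∀ x, |fderiv ℝ w x (V x)| ≤ D) :
    TransportDeriv V w fun x => fderiv ℝ w x (V x) :=
  ⟨max C D, fun _ => w, fun _ => hw, fun _ x => (hC x).trans (le_max_left _ _),
    fun _ x => (hD x).trans (le_max_right _ _), fun _ => tendsto_const_nhds,
    fun _ => tendsto_const_nhds⟩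

/-- The left integrand is `φ` times the derivative of `(|w|² + δ)^a - δ^a` along `V`. The shift by
`δ` keeps the power `C¹` at zeros of `w`; subtracting `δ^a` makes the function vanish there, which
later allows a bound by `|w|^(2a)`. -/
theorem integral_renormalized_of_contDiff {V : E3 → E3} (hV : ContDiff ℝ 1 V) {w : Fin 3 → E3 → ℝ}
    (hw : ∀ i, ContDiff ℝ 1 (w i)) {φ : E3 → ℝ} (hφ : ContDiff ℝ 1 φ) (hφc : HasCompactSupport φ)
    {δ a : ℝ} (hδ : 0 < δ) :
    ∫ x, φ x * (a * ((∑ i, w i x ^ 2) + δ) ^ (a - 1) *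
        (2 * ∑ i, w i x * fderiv ℝ (w i) x (V x)))
      = -∫ x, (((∑ i, w i x ^ 2) + δ) ^ a - δ ^ a) *
        (φ x * divergence V x + fderiv ℝ φ x (V x)) := by
  have hN : ContDiff ℝ 1 fun x => (∑ i, w i x ^ 2) + δ :=
    (ContDiff.sum fun i _ => (hw i).pow 2).add contDiff_const
  have hpos : ∀ x, 0 < (∑ i, w i x ^ 2) + δ := fun x =>
    add_pos_of_nonneg_of_pos (Finset.sum_nonneg fun i _ => sq_nonneg _) hδ
  have hh : ContDiff ℝ 1 fun x => ((∑ i, w i x ^ 2) + δ) ^ a - δ ^ a :=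
    (hN.rpow_const_of_ne fun x => (hpos x).ne').sub contDiff_const
  rw [← integral_mul_fderiv_apply_field hh hV hφ hφc]
  congr 1
  ext x
  congr 1
  have hd : ∀ i, HasFDerivAt (fun x => w i x ^ 2) ((2 * w i x) • fderiv ℝ (w i) x) x := by
    intro i
    have := ((hw i).differentiable one_ne_zero x).hasFDerivAt.pow 2
    simpa using this
  have hS : HasFDerivAt (fun x => (∑ i, w i x ^ 2) + δ)
      (∑ i, (2 * w i x) • fderiv ℝ (w i) x) x :=
    (HasFDerivAt.fun_sum fun i _ => hd i).add_const δ
  rw [((hS.rpow_const (p := a) (Or.inl (hpos x).ne')).sub_const (δ ^ a)).fderiv]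
  simp only [smul_apply, sum_apply, smul_eq_mul,
    Finset.mul_sum]
  exact Finset.sum_congr rfl fun i _ => by ring

/-- The chain rule is used only on the `C¹` approximations. Their uniform bounds, `(N + δ)^(a-1) ≤
δ^(a-1)` and the compact support of `φ` then give dominated convergence on both sides. -/
theorem integral_renormalized {V : E3 → E3} (hV : ContDiff ℝ 1 V) {w b : Fin 3 → E3 → ℝ}
    (hw : ∀ i, TransportDeriv V (w i) (b i)) {φ : E3 → ℝ} (hφ : ContDiff ℝ 1 φ)
    (hφc : HasCompactSupport φ) (hdiv : Continuous (divergence V))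
    {δ a : ℝ} (hδ : 0 < δ) (ha : 0 < a) (ha1 : a < 1) :
    ∫ x, φ x * (a * ((∑ i, w i x ^ 2) + δ) ^ (a - 1) * (2 * ∑ i, w i x * b i x))
      = -∫ x, (((∑ i, w i x ^ 2) + δ) ^ a - δ ^ a) *
        (φ x * divergence V x + fderiv ℝ φ x (V x)) := by
  choose C wn h1 h2 h3 h4 h5 using hw
  have hpos0 : ∀ n x, 0 ≤ ∑ i, wn i n x ^ 2 := fun n x => Finset.sum_nonneg fun i _ => sq_nonneg _
  have hpos : ∀ n x, 0 < (∑ i, wn i n x ^ 2) + δ := fun n x =>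
    add_pos_of_nonneg_of_pos (hpos0 n x) hδ
  have hlim : ∀ x, 0 < (∑ i, w i x ^ 2) + δ := fun x =>
    add_pos_of_nonneg_of_pos (Finset.sum_nonneg fun i _ => sq_nonneg _) hδ
  have hC : ∀ n x, ∑ i, wn i n x ^ 2 ≤ ∑ i, C i ^ 2 := fun n x =>
    Finset.sum_le_sum fun i _ => sq_le_sq' (abs_le.1 (h2 i n x)).1 (abs_le.1 (h2 i n x)).2
  have hWt : ∀ x, Tendsto (fun n => (∑ i, wn i n x ^ 2) + δ) atTop (𝓝 ((∑ i, w i x ^ 2) + δ)) :=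
    fun x => (tendsto_finsetSum _ fun i _ => (h4 i x).pow 2).add_const δ
  have hcN : ∀ n, Continuous fun x => (∑ i, wn i n x ^ 2) + δ := fun n =>
    (continuous_finsetSum _ fun i _ => (h1 i n).continuous.pow 2).add continuous_const
  have hcd : ∀ i n, Continuous fun x => fderiv ℝ (wn i n) x (V x) := fun i n =>
    ((h1 i n).continuous_fderiv one_ne_zero).clm_apply hV.continuous
  have hψc : Continuous fun x => φ x * divergence V x + fderiv ℝ φ x (V x) :=
    (hφ.continuous.mul hdiv).add ((hφ.continuous_fderiv one_ne_zero).clm_apply hV.continuous)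
  have hψs : HasCompactSupport fun x => φ x * divergence V x + fderiv ℝ φ x (V x) := by
    refine HasCompactSupport.add hφc.mul_right ?_
    refine (hφc.fderiv ℝ).mono fun x hx h0 => hx ?_
    simp [h0]
  have L : Tendsto (fun n => ∫ x, φ x * (a * ((∑ i, wn i n x ^ 2) + δ) ^ (a - 1) *
      (2 * ∑ i, wn i n x * fderiv ℝ (wn i n) x (V x)))) atTop
      (𝓝 (∫ x, φ x * (a * ((∑ i, w i x ^ 2) + δ) ^ (a - 1) * (2 * ∑ i, w i x * b i x)))) := by
    refine tendsto_integral_of_dominated_convergence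
      (fun x => |φ x| * (a * δ ^ (a - 1) * (2 * ∑ i, C i * C i))) ?_ ?_ ?_ ?_
    · intro n
      refine Continuous.aestronglyMeasurable ?_
      refine hφ.continuous.mul ((continuous_const.mul
        ((hcN n).rpow_const fun x => Or.inl (hpos n x).ne')).mul (continuous_const.mul
        (continuous_finsetSum _ fun i _ => (h1 i n).continuous.mul (hcd i n))))
    · exact (hφ.continuous.abs.integrable_of_hasCompactSupport hφc.abs).mul_const _
    · intro n
      refine Eventually.of_forall fun x => ?_
      rw [Real.norm_eq_abs, abs_mul, abs_mul, abs_mul, abs_mul, abs_of_pos ha, abs_two,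
        abs_of_pos (Real.rpow_pos_of_pos (hpos n x) _)]
      have e1 : ((∑ i, wn i n x ^ 2) + δ) ^ (a - 1) ≤ δ ^ (a - 1) :=
        Real.rpow_le_rpow_of_nonpos hδ (by linarith [hpos0 n x]) (by linarith)
      have e2 : |∑ i, wn i n x * fderiv ℝ (wn i n) x (V x)| ≤ ∑ i, C i * C i := by
        refine (Finset.abs_sum_le_sum_abs _ _).trans (Finset.sum_le_sum fun i _ => ?_)
        rw [abs_mul]
        exact mul_le_mul (h2 i n x) (h3 i n x) (abs_nonneg _) ((abs_nonneg _).trans (h2 i n x))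
      exact mul_le_mul_of_nonneg_left (mul_le_mul (mul_le_mul_of_nonneg_left e1 ha.le)
        (mul_le_mul_of_nonneg_left e2 zero_le_two) (by positivity) (by positivity)) (abs_nonneg _)
    · refine Eventually.of_forall fun x => ?_
      exact (((hWt x).rpow_const (Or.inl (hlim x).ne')).const_mul a |>.mul
        ((tendsto_finsetSum _ fun i _ => (h4 i x).mul (h5 i x)).const_mul 2)).const_mul _
  have R : Tendsto (fun n => -∫ x, (((∑ i, wn i n x ^ 2) + δ) ^ a - δ ^ a) *
        (φ x * divergence V x + fderiv ℝ φ x (V x))) atTop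
      (𝓝 (-∫ x, (((∑ i, w i x ^ 2) + δ) ^ a - δ ^ a) *
        (φ x * divergence V x + fderiv ℝ φ x (V x)))) := by
    refine Tendsto.neg (tendsto_integral_of_dominated_convergence
      (fun x => ((∑ i, C i ^ 2) + δ) ^ a * |φ x * divergence V x + fderiv ℝ φ x (V x)|)
      ?_ ?_ ?_ ?_)
    · intro n
      exact ((((hcN n).rpow_const fun x => Or.inl (hpos n x).ne').sub continuous_const).mul
        hψc).aestronglyMeasurable
    · exact (hψc.abs.integrable_of_hasCompactSupport hψs.abs).const_mul _
    · intro n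
      refine Eventually.of_forall fun x => ?_
      rw [Real.norm_eq_abs, abs_mul]
      gcongr
      have e1 : δ ^ a ≤ ((∑ i, wn i n x ^ 2) + δ) ^ a :=
        Real.rpow_le_rpow hδ.le (by linarith [hpos0 n x]) ha.le
      have e2 : ((∑ i, wn i n x ^ 2) + δ) ^ a ≤ ((∑ i, C i ^ 2) + δ) ^ a :=
        Real.rpow_le_rpow (hpos n x).le (by linarith [hC n x]) ha.le
      rw [abs_of_nonneg (by linarith)]
      linarith [Real.rpow_pos_of_pos hδ a]
    · refine Eventually.of_forall fun x => ?_
      exact (((hWt x).rpow_const (Or.inl (hlim x).ne')).sub_const _).mul_const _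
  simp only [fun n => integral_renormalized_of_contDiff hV (fun i => h1 i n) hφ hφc (a := a) hδ]
    at L
  exact tendsto_nhds_unique L R

/-! ### Cutoffs and the vanishing criterion -/

/-- A cutoff function at scale `n + 1`. -/
noncomputable def cutoff (f : ContDiffBump (0 : E3)) (n : ℕ) (x : E3) : ℝ := f (((n : ℝ) + 1)⁻¹ • x)

theorem contDiff_cutoff (f : ContDiffBump (0 : E3)) (n : ℕ) : ContDiff ℝ 1 (cutoff f n) :=
  f.contDiff.comp (contDiff_const_smul _)

theorem hasCompactSupport_cutoff (f : ContDiffBump (0 : E3)) (n : ℕ) :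
    HasCompactSupport (cutoff f n) :=
  f.hasCompactSupport.comp_smul (by positivity)

theorem fderiv_cutoff (f : ContDiffBump (0 : E3)) (n : ℕ) (x v : E3) :
    fderiv ℝ (cutoff f n) x v = fderiv ℝ f (((n : ℝ) + 1)⁻¹ • x) (((n : ℝ) + 1)⁻¹ • v) := by
  have h := (f.contDiff (n := 1)).differentiable one_ne_zero (((n : ℝ) + 1)⁻¹ • x)
  have h2 : HasFDerivAt (fun x : E3 => ((n : ℝ) + 1)⁻¹ • x)
      (((n : ℝ) + 1)⁻¹ • ContinuousLinearMap.id ℝ E3) x :=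
    ((((n : ℝ) + 1)⁻¹ • ContinuousLinearMap.id ℝ E3)).hasFDerivAt
  have h3 := h.hasFDerivAt.comp x h2
  have h4 : cutoff f n = f ∘ fun x : E3 => ((n : ℝ) + 1)⁻¹ • x := rfl
  rw [h4, h3.fderiv]
  rfl

theorem tendsto_inv_smul_zero (x : E3) :
    Tendsto (fun n : ℕ => ((n : ℝ) + 1)⁻¹ • x) atTop (𝓝 0) := by
  have := (tendsto_one_div_add_atTop_nhds_zero_nat (𝕜 := ℝ)).smul_const x
  simpa using this

theorem cutoff_eventually (f : ContDiffBump (0 : E3)) (x : E3) :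
    ∀ᶠ n in atTop, cutoff f n x = 1 ∧ ∀ v, fderiv ℝ (cutoff f n) x v = 0 := by
  filter_upwards [(tendsto_inv_smul_zero x).eventually f.eventuallyEq_one.eventuallyEq_nhds]
    with n hn
  refine ⟨hn.self_of_nhds, fun v => ?_⟩
  rw [fderiv_cutoff, hn.fderiv_eq]
  simp

/-- The factor `1/(n+1)` from differentiating the cutoff balances the linear growth of `V` on its
support, where `‖x‖ ≤ rOut (n+1)`. -/
theorem exists_bound_fderiv_cutoff (f : ContDiffBump (0 : E3)) {V : E3 → E3} {K : ℝ}
    (hVb : ∀ x, ‖V x‖ ≤ ‖x‖ + K) : ∃ D, ∀ n x, |fderiv ℝ (cutoff f n) x (V x)| ≤ D := by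
  have hfc : Continuous (fderiv ℝ f) := (f.contDiff (n := 1)).continuous_fderiv one_ne_zero
  obtain ⟨M, hM⟩ := (f.hasCompactSupport.fderiv ℝ).exists_bound_of_continuous hfc
  have hM0 : 0 ≤ M := (norm_nonneg _).trans (hM 0)
  refine ⟨M * (f.rOut + |K|), fun n x => ?_⟩
  rw [fderiv_cutoff]
  by_cases hx : ((n : ℝ) + 1)⁻¹ • x ∈ Metric.closedBall (0 : E3) f.rOut
  · rw [← Real.norm_eq_abs]
    refine (ContinuousLinearMap.le_opNorm _ _).trans (mul_le_mul (hM _) ?_ (norm_nonneg _) hM0)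
    rw [mem_closedBall_zero_iff, norm_smul, Real.norm_of_nonneg (by positivity)] at hx
    rw [norm_smul, Real.norm_of_nonneg (by positivity)]
    have h1 : ((n : ℝ) + 1)⁻¹ ≤ 1 := inv_le_one_of_one_le₀ (by linarith [n.cast_nonneg (α := ℝ)])
    have h2 : (0 : ℝ) ≤ ((n : ℝ) + 1)⁻¹ := by positivity
    calc ((n : ℝ) + 1)⁻¹ * ‖V x‖ ≤ ((n : ℝ) + 1)⁻¹ * (‖x‖ + |K|) := by
          gcongr; exact (hVb x).trans (by linarith [le_abs_self K])
      _ ≤ f.rOut + |K| := by nlinarith [abs_nonneg K]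
  · rw [← f.tsupport_eq] at hx
    have : fderiv ℝ f (((n : ℝ) + 1)⁻¹ • x) = 0 := by
      by_contra h
      exact hx (support_fderiv_subset ℝ h)
    rw [this]
    simp only [zero_apply, abs_zero]
    have := f.rOut_pos
    positivity

/-- A triple with small powers integrable whose derivative along an expanding field `V` is
pointwise dominated by it vanishes. -/
theorem eq_zero_of_transportDeriv {V : E3 → E3} (hV : ContDiff ℝ 1 V)
    (hdiv : ∀ x, divergence V x = 3 / 2) {K : ℝ} (hVb : ∀ x, ‖V x‖ ≤ ‖x‖ + K)
    {w b : Fin 3 → E3 → ℝ} (hwc : ∀ i, Continuous (w i)) (hbc : ∀ i, Continuous (b i))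
    (hw : ∀ i, TransportDeriv V (w i) (b i)) {C : ℝ} (hC : 0 ≤ C)
    (hwb : ∀ x, |∑ i, w i x * b i x| ≤ C * ∑ i, w i x ^ 2) {q : ℝ} (hq : 0 < q)
    (hint : ∀ a, 0 < a → a < q → Integrable (fun x => (∑ i, w i x ^ 2) ^ a)) :
    ∀ i, w i = 0 := by
  -- The bound by `1` gives subadditivity of `t ↦ t^a`, the bound by `q` integrability, and the last
  -- one `2aC ≤ 1`, strictly below the expansion rate `3/2`.
  obtain ⟨a, ha, ha'⟩ : ∃ a, 0 < a ∧ a < min (min 1 q) (1 / (2 * (C + 1))) :=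
    exists_between (by positivity)
  have ha1 : a < 1 := ha'.trans_le ((min_le_left _ _).trans (min_le_left _ _))
  have haq : a < q := ha'.trans_le ((min_le_left _ _).trans (min_le_right _ _))
  have haC : a < 1 / (2 * (C + 1)) := ha'.trans_le (min_le_right _ _)
  have haC' : 2 * a * C ≤ 1 := by
    rw [lt_div_iff₀ (by positivity)] at haC
    nlinarith
  set N : E3 → ℝ := fun x => ∑ i, w i x ^ 2 with hN
  have hN0 : ∀ x, 0 ≤ N x := fun x => Finset.sum_nonneg fun i _ => sq_nonneg _
  have hNc : Continuous N := continuous_finsetSum _ fun i _ => (hwc i).pow 2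
  have hNa : Continuous fun x => N x ^ a := hNc.rpow_const fun x => Or.inr ha.le
  have hI := hint a ha haq
  let f : ContDiffBump (0 : E3) := ⟨1, 2, one_pos, one_lt_two⟩
  obtain ⟨D, hD⟩ := exists_bound_fderiv_cutoff f hVb
  set δ : ℕ → ℝ := fun n => 1 / ((n : ℝ) + 1) with hδ
  have hδ0 : ∀ n, 0 < δ n := fun n => by positivity
  have hδt : Tendsto δ atTop (𝓝 0) := tendsto_one_div_add_atTop_nhds_zero_nat
  have hNδ : ∀ n x, 0 < N x + δ n := fun n x => add_pos_of_nonneg_of_pos (hN0 x) (hδ0 n)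
  have hGc : ∀ n, Continuous fun x => (N x + δ n) ^ a - δ n ^ a := fun n =>
    ((hNc.add continuous_const).rpow_const fun x => Or.inl (hNδ n x).ne').sub continuous_const
  have hG0 : ∀ n x, 0 ≤ (N x + δ n) ^ a - δ n ^ a := fun n x =>
    sub_nonneg.2 (Real.rpow_le_rpow (hδ0 n).le (by linarith [hN0 x]) ha.le)
  have hG1 : ∀ n x, (N x + δ n) ^ a - δ n ^ a ≤ N x ^ a := fun n x => by
    linarith [Real.rpow_add_le_add_rpow (hN0 x) (hδ0 n).le ha.le ha1.le]
  have hφ0 : ∀ n x, 0 ≤ cutoff f n x := fun n x => f.nonneg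
  have hφ1 : ∀ n x, cutoff f n x ≤ 1 := fun n x => f.le_one
  have hφc : ∀ n, Continuous (cutoff f n) := fun n => (contDiff_cutoff f n).continuous
  have hdφc : ∀ n, Continuous fun x => fderiv ℝ (cutoff f n) x (V x) := fun n =>
    ((contDiff_cutoff f n).continuous_fderiv one_ne_zero).clm_apply hV.continuous
  have hpow : ∀ n x, (N x + δ n) ^ (a - 1) * N x ≤ N x ^ a := by
    intro n x
    -- Zeros of `N` are treated apart: the negative power `N^(a-1)` is antitone only on positive
    -- bases.
    rcases (hN0 x).eq_or_lt with h | h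
    · rw [← h, mul_zero]; exact Real.rpow_nonneg le_rfl _
    · calc (N x + δ n) ^ (a - 1) * N x ≤ N x ^ (a - 1) * N x := by
            refine mul_le_mul_of_nonneg_right ?_ h.le
            exact Real.rpow_le_rpow_of_nonpos h (by linarith [hδ0 n]) (by linarith)
        _ = N x ^ a := by rw [Real.rpow_sub_one h.ne', div_mul_cancel₀ _ h.ne']
  have i1 : ∀ n, Integrable fun x => ((N x + δ n) ^ a - δ n ^ a) * cutoff f n x := fun n =>
    ((hGc n).mul (hφc n)).integrable_of_hasCompactSupport (hasCompactSupport_cutoff f n).mul_left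
  have sd : ∀ n, HasCompactSupport fun x => fderiv ℝ (cutoff f n) x (V x) := fun n =>
    ((hasCompactSupport_cutoff f n).fderiv ℝ).mono fun x hx h0 => hx (by simp [h0])
  have i2 : ∀ n, Integrable fun x =>
      ((N x + δ n) ^ a - δ n ^ a) * fderiv ℝ (cutoff f n) x (V x) := fun n =>
    ((hGc n).mul (hdφc n)).integrable_of_hasCompactSupport (sd n).mul_left
  have i3 : ∀ n, Integrable fun x => N x ^ a * |fderiv ℝ (cutoff f n) x (V x)| := fun n =>
    (hNa.mul (hdφc n).abs).integrable_of_hasCompactSupport (sd n).abs.mul_left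
  have i4 : ∀ n, Integrable fun x =>
      cutoff f n x * (a * (N x + δ n) ^ (a - 1) * (2 * ∑ i, w i x * b i x)) := fun n =>
    ((hφc n).mul ((continuous_const.mul ((hNc.add continuous_const).rpow_const
      fun x => Or.inl (hNδ n x).ne')).mul (continuous_const.mul
      (continuous_finsetSum _ fun i _ => (hwc i).mul (hbc i))))).integrable_of_hasCompactSupport
      (hasCompactSupport_cutoff f n).mul_right
  have key : ∀ n, 3 / 2 * ∫ x, ((N x + δ n) ^ a - δ n ^ a) * cutoff f n x
      ≤ 2 * a * C * (∫ x, N x ^ a) + ∫ x, N x ^ a * |fderiv ℝ (cutoff f n) x (V x)| := by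
    intro n
    have h := integral_renormalized hV hw (contDiff_cutoff f n) (hasCompactSupport_cutoff f n)
      (by simp only [funext hdiv]; exact continuous_const) (hδ0 n) ha ha1
    have e : ∫ x, ((∑ i, w i x ^ 2 + δ n) ^ a - δ n ^ a) *
        (cutoff f n x * divergence V x + fderiv ℝ (cutoff f n) x (V x))
        = 3 / 2 * (∫ x, ((N x + δ n) ^ a - δ n ^ a) * cutoff f n x)
          + ∫ x, ((N x + δ n) ^ a - δ n ^ a) * fderiv ℝ (cutoff f n) x (V x) := by
      rw [← integral_const_mul, ← integral_add ((i1 n).const_mul _) (i2 n)]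
      congr 1
      ext x
      rw [hdiv]
      ring
    rw [e] at h
    have b1 : -∫ x, cutoff f n x * (a * (N x + δ n) ^ (a - 1) * (2 * ∑ i, w i x * b i x))
        ≤ 2 * a * C * (∫ x, N x ^ a) := by
      rw [← integral_neg, ← integral_const_mul]
      refine integral_mono (i4 n).neg (hI.const_mul _) fun x => ?_
      refine (neg_le_abs _).trans ?_
      rw [abs_mul, abs_mul, abs_mul, abs_mul, abs_of_pos ha, abs_two,
        abs_of_pos (Real.rpow_pos_of_pos (hNδ n x) _), abs_of_nonneg (hφ0 n x)]
      have hp := Real.rpow_pos_of_pos (hNδ n x) (a - 1)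
      calc cutoff f n x * (a * (N x + δ n) ^ (a - 1) * (2 * |∑ i, w i x * b i x|))
          ≤ 1 * (a * (N x + δ n) ^ (a - 1) * (2 * (C * N x))) := by
            gcongr
            · exact hφ1 n x
            · exact hwb x
        _ = 2 * a * C * ((N x + δ n) ^ (a - 1) * N x) := by ring
        _ ≤ 2 * a * C * N x ^ a := by
            gcongr
            exact hpow n x
    have b2 : -∫ x, ((N x + δ n) ^ a - δ n ^ a) * fderiv ℝ (cutoff f n) x (V x)
        ≤ ∫ x, N x ^ a * |fderiv ℝ (cutoff f n) x (V x)| := by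
      rw [← integral_neg]
      refine integral_mono (i2 n).neg (i3 n) fun x => ?_
      refine (neg_le_abs _).trans ?_
      rw [abs_mul, abs_of_nonneg (hG0 n x)]
      exact mul_le_mul_of_nonneg_right (hG1 n x) (abs_nonneg _)
    linarith
  have L : Tendsto (fun n => ∫ x, ((N x + δ n) ^ a - δ n ^ a) * cutoff f n x) atTop
      (𝓝 (∫ x, N x ^ a)) := by
    refine tendsto_integral_of_dominated_convergence (fun x => N x ^ a)
      (fun n => (i1 n).aestronglyMeasurable) hI ?_ ?_
    · refine fun n => Eventually.of_forall fun x => ?_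
      rw [Real.norm_of_nonneg (mul_nonneg (hG0 n x) (hφ0 n x))]
      calc _ ≤ N x ^ a * 1 := mul_le_mul (hG1 n x) (hφ1 n x) (hφ0 n x)
              (Real.rpow_nonneg (hN0 x) _)
        _ = N x ^ a := mul_one _
    · refine Eventually.of_forall fun x => ?_
      have t1 : Tendsto (fun n => (N x + δ n) ^ a - δ n ^ a) atTop (𝓝 (N x ^ a)) := by
        have := ((hδt.const_add (N x)).rpow_const (p := a) (Or.inr ha.le)).sub
          (hδt.rpow_const (p := a) (Or.inr ha.le))
        simpa [Real.zero_rpow ha.ne'] using this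
      have t2 : Tendsto (fun n => cutoff f n x) atTop (𝓝 1) :=
        tendsto_const_nhds.congr' ((cutoff_eventually f x).mono fun n hn => hn.1.symm)
      simpa using t1.mul t2
  have R : Tendsto (fun n => ∫ x, N x ^ a * |fderiv ℝ (cutoff f n) x (V x)|) atTop (𝓝 0) := by
    rw [← integral_zero E3 ℝ (μ := volume)]
    refine tendsto_integral_of_dominated_convergence (fun x => N x ^ a * D)
      (fun n => (i3 n).aestronglyMeasurable) (hI.mul_const _) ?_ ?_
    · refine fun n => Eventually.of_forall fun x => ?_
      have := Real.rpow_nonneg (hN0 x) a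
      rw [Real.norm_of_nonneg (by positivity)]
      exact mul_le_mul_of_nonneg_left (hD n x) this
    · refine Eventually.of_forall fun x => ?_
      refine tendsto_const_nhds.congr' ((cutoff_eventually f x).mono fun n hn => ?_)
      simp [hn.2]
  -- In the limit `3/2 ∫ N^a ≤ 2aC ∫ N^a ≤ ∫ N^a`, which forces the integral to vanish.
  have final := le_of_tendsto_of_tendsto' (L.const_mul (3 / 2)) (R.const_add _) key
  have I0 : 0 ≤ ∫ x, N x ^ a := integral_nonneg fun x => Real.rpow_nonneg (hN0 x) _
  have hz : ∫ x, N x ^ a = 0 := by nlinarith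
  rw [integral_eq_zero_iff_of_nonneg (fun x => Real.rpow_nonneg (hN0 x) _) hI] at hz
  have hz' : (fun x => N x ^ a) = 0 :=
    (Continuous.ae_eq_iff_eq volume hNa continuous_const).1 hz
  intro i
  ext x
  have h1 : N x = 0 := (Real.rpow_eq_zero (hN0 x) ha.ne').1 (congrFun hz' x)
  have h2 := (Finset.sum_eq_zero_iff_of_nonneg fun i _ => sq_nonneg (w i x)).1 h1 i
    (Finset.mem_univ i)
  simpa using h2

/-! ### Mollification of continuous functions -/

/-- The average of `g` at scale `ε` with weight `ρ`. -/
noncomputable def moll (ρ : E3 → ℝ) (ε : ℝ) (g : E3 → ℝ) (x : E3) : ℝ :=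
  ∫ z, ρ z * g (x - ε • z)

theorem fderiv_comp_sub_smul {F : Type*} [NormedAddCommGroup F] [NormedSpace ℝ F] {f : E3 → F}
    (hf : Differentiable ℝ f) (x : E3) (ε : ℝ) (z v : E3) :
    fderiv ℝ (fun z => f (x - ε • z)) z v = -(ε • fderiv ℝ f (x - ε • z) v) := by
  have h2 : HasFDerivAt (fun z : E3 => x - ε • z) (-(ε • ContinuousLinearMap.id ℝ E3)) z :=
    ((ε • ContinuousLinearMap.id ℝ E3).hasFDerivAt).const_sub x
  have h3 := ((hf (x - ε • z)).hasFDerivAt).comp z h2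
  have h4 : (fun z => f (x - ε • z)) = f ∘ fun z : E3 => x - ε • z := rfl
  rw [h4, h3.fderiv]
  simp

theorem contDiff_comp_sub_smul {f : E3 → ℝ} (hf : ContDiff ℝ 1 f) (x : E3) (ε : ℝ) :
    ContDiff ℝ 1 fun z => f (x - ε • z) :=
  hf.comp (contDiff_const.sub (contDiff_const_smul ε))

section Kernel

variable {ρ : E3 → ℝ} (hρ : ContDiff ℝ 2 ρ) (hρc : HasCompactSupport ρ)

theorem moll_eq_convolution {ε : ℝ} (hε : 0 < ε) (g : E3 → ℝ) :
    moll ρ ε g = convolution (fun w => (ε ^ 3)⁻¹ * ρ (ε⁻¹ • w)) g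
      (ContinuousLinearMap.mul ℝ ℝ) volume := by
  ext x
  have h := Measure.integral_comp_smul (volume : Measure E3)
    (fun z => ρ z * g (x - ε • z)) ε⁻¹
  simp only [finrank_euclideanSpace, Fintype.card_fin, inv_pow, inv_inv, smul_smul,
    mul_inv_cancel₀ hε.ne', one_smul, smul_eq_mul] at h
  rw [abs_of_pos (by positivity)] at h
  rw [convolution_def]
  simp only [ContinuousLinearMap.mul_apply', mul_assoc]
  rw [integral_const_mul, h, ← mul_assoc, inv_mul_cancel₀ (by positivity), one_mul, moll]

include hρ in
theorem contDiff_kernel (ε : ℝ) : ContDiff ℝ 1 (fun w => (ε ^ 3)⁻¹ * ρ (ε⁻¹ • w)) :=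
  contDiff_const.mul ((hρ.of_le one_le_two).comp (contDiff_const_smul _))

include hρc in
theorem hasCompactSupport_kernel {ε : ℝ} (hε : 0 < ε) :
    HasCompactSupport (fun w => (ε ^ 3)⁻¹ * ρ (ε⁻¹ • w)) :=
  (hρc.comp_smul (inv_ne_zero hε.ne')).mul_left

include hρ hρc

theorem contDiff_moll {ε : ℝ} (hε : 0 < ε) {g : E3 → ℝ} (hg : Continuous g) :
    ContDiff ℝ 1 (moll ρ ε g) := by
  rw [moll_eq_convolution hε]
  exact (hasCompactSupport_kernel hρc hε).contDiff_convolution_left _ (n := 1)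
    (contDiff_kernel hρ ε) hg.locallyIntegrable

/-- The derivative falls on the kernel, so continuity of `g` is enough; the price is the factor
`ε⁻¹`. -/
theorem fderiv_moll {ε : ℝ} (hε : 0 < ε) {g : E3 → ℝ} (hg : Continuous g) (x v : E3) :
    fderiv ℝ (moll ρ ε g) x v = ε⁻¹ * ∫ z, fderiv ℝ ρ z v * g (x - ε • z) := by
  have hK := contDiff_kernel hρ ε
  have hKc := hasCompactSupport_kernel hρc hε
  rw [moll_eq_convolution hε, (hKc.hasFDerivAt_convolution_left (ContinuousLinearMap.mul ℝ ℝ) hK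
    hg.locallyIntegrable x).fderiv, convolution_def, ContinuousLinearMap.integral_apply]
  · have hd : ∀ w, fderiv ℝ (fun w => (ε ^ 3)⁻¹ * ρ (ε⁻¹ • w)) w v
        = (ε ^ 3)⁻¹ * (ε⁻¹ * fderiv ℝ ρ (ε⁻¹ • w) v) := by
      intro w
      have h2 : HasFDerivAt (fun z : E3 => ε⁻¹ • z) (ε⁻¹ • ContinuousLinearMap.id ℝ E3) w :=
        (ε⁻¹ • ContinuousLinearMap.id ℝ E3).hasFDerivAt
      have h3 := (((hρ.differentiable two_ne_zero (ε⁻¹ • w)).hasFDerivAt).comp w h2).const_mul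
        (ε ^ 3)⁻¹
      have h4 : (fun w => (ε ^ 3)⁻¹ * ρ (ε⁻¹ • w))
        = fun w => (ε ^ 3)⁻¹ * (ρ ∘ fun z : E3 => ε⁻¹ • z) w := rfl
      rw [h4, h3.fderiv]
      simp
    simp only [ContinuousLinearMap.precompL_apply, ContinuousLinearMap.mul_apply', hd]
    have h := congrFun (moll_eq_convolution (ρ := fun z => fderiv ℝ ρ z v) hε g) x
    rw [convolution_def, moll] at h
    simp only [ContinuousLinearMap.mul_apply'] at h
    rw [h, ← integral_const_mul]
    exact integral_congr_ae (Eventually.of_forall fun w => by ring)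
  · refine Continuous.integrable_of_hasCompactSupport ?_ ?_
    · have h1 := hK.continuous_fderiv one_ne_zero
      exact (((ContinuousLinearMap.mul ℝ ℝ).precompL E3).continuous.comp h1).clm_apply
        (hg.comp (continuous_const.sub continuous_id))
    · exact (hKc.fderiv ℝ).mono fun x hx h0 => hx (by simp [h0])

/-- Weak symmetry of second derivatives, applied to `z ↦ f (x - ε z)`; the chain rule factor `-ε`
cancels. This exchanges directions of differentiation without a second derivative of `f`. -/
theorem integral_fderiv_shift_comm {f : E3 → ℝ} (hf : ContDiff ℝ 1 f) {ε : ℝ} (hε : 0 < ε)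
    (x a b : E3) :
    ∫ z, fderiv ℝ ρ z b * fderiv ℝ f (x - ε • z) a
      = ∫ z, fderiv ℝ ρ z a * fderiv ℝ f (x - ε • z) b := by
  have h := integral_fderiv_mul_fderiv_comm (contDiff_comp_sub_smul hf x ε) hρ hρc a b
  simp only [fderiv_comp_sub_smul (hf.differentiable one_ne_zero)] at h
  have e : ∀ u v : E3, ∫ z, -(ε • fderiv ℝ f (x - ε • z) u) * fderiv ℝ ρ z v
      = -ε * ∫ z, fderiv ℝ ρ z v * fderiv ℝ f (x - ε • z) u := by
    intro u v
    rw [← integral_const_mul]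
    congr 1
    ext z
    simp only [smul_eq_mul]
    ring
  rw [e, e] at h
  exact mul_left_cancel₀ (neg_ne_zero.2 hε.ne') h

theorem inv_mul_integral_fderiv_shift {f : E3 → ℝ} (hf : ContDiff ℝ 1 f) {ε : ℝ} (hε : 0 < ε)
    (x a : E3) :
    ε⁻¹ * ∫ z, fderiv ℝ ρ z a * f (x - ε • z) = moll ρ ε (fun y => fderiv ℝ f y a) x := by
  have h' := integral_fderiv_mul_eq_neg (contDiff_comp_sub_smul hf x ε) (hρ.of_le one_le_two)
    hρc a
  simp only [fderiv_comp_sub_smul (hf.differentiable one_ne_zero)] at h'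
  have e : ∫ z, f (x - ε • z) * fderiv ℝ ρ z a = ε * moll ρ ε (fun y => fderiv ℝ f y a) x := by
    rw [← neg_inj, ← h', moll, ← integral_const_mul, ← integral_neg]
    congr 1
    ext z
    simp only [smul_eq_mul]
    ring
  simp only [mul_comm (fderiv ℝ ρ _ a)]
  rw [e, ← mul_assoc, inv_mul_cancel₀ hε.ne', one_mul]

/-- The first moments of `∂_a ρ`, which evaluate the limit of the commutator. -/
theorem integral_fderiv_mul_clm (a : E3) (l : E3 →L[ℝ] ℝ) :
    ∫ z, fderiv ℝ ρ z a * l z = -(l a * ∫ z, ρ z) := by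
  have h := integral_fderiv_mul_eq_neg l.contDiff (hρ.of_le one_le_two) hρc a
  simp only [ContinuousLinearMap.fderiv] at h
  rw [← integral_const_mul, h, neg_neg]
  congr 1
  ext z
  ring

theorem abs_moll_le {g : E3 → ℝ} {M : ℝ} (hM : ∀ x, |g x| ≤ M) (ε : ℝ) (x : E3) :
    |moll ρ ε g x| ≤ M * ∫ z, |ρ z| := by
  rw [moll, ← Real.norm_eq_abs, ← integral_const_mul]
  refine norm_integral_le_of_norm_le
    ((hρ.continuous.abs.integrable_of_hasCompactSupport hρc.abs).const_mul M)
    (Eventually.of_forall fun z => ?_)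
  rw [Real.norm_eq_abs, abs_mul, mul_comm]
  exact mul_le_mul_of_nonneg_right (hM _) (abs_nonneg _)

theorem tendsto_moll {g : E3 → ℝ} (hg : Continuous g) {M : ℝ} (hM : ∀ x, |g x| ≤ M)
    {ε : ℕ → ℝ} (hε : Tendsto ε atTop (𝓝 0)) (x : E3) :
    Tendsto (fun n => moll ρ (ε n) g x) atTop (𝓝 ((∫ z, ρ z) * g x)) := by
  rw [← integral_mul_const]
  refine tendsto_integral_of_dominated_convergence (fun z => |ρ z| * M) ?_
    ((hρ.continuous.abs.integrable_of_hasCompactSupport hρc.abs).mul_const M) ?_ ?_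
  · exact fun n => (hρ.continuous.mul (hg.comp (by fun_prop))).aestronglyMeasurable
  · refine fun n => Eventually.of_forall fun z => ?_
    rw [Real.norm_eq_abs, abs_mul]
    exact mul_le_mul_of_nonneg_left (hM _) (abs_nonneg _)
  · refine Eventually.of_forall fun z => Tendsto.const_mul _ ?_
    have : Tendsto (fun n => x - ε n • z) atTop (𝓝 x) := by
      simpa using (hε.smul_const z).const_sub x
    exact (hg.tendsto x).comp this

end Kernel

/-! ### Commutator of mollification with the derivative along a Lipschitz field -/

section Commutator

variable {ρ : E3 → ℝ} (hρ : ContDiff ℝ 2 ρ) (hρc : HasCompactSupport ρ)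
  {V : E3 → E3} (hV : ContDiff ℝ 1 V) {L : ℝ} (hL : ∀ x y, ‖V x - V y‖ ≤ L * ‖x - y‖)
  {f : E3 → ℝ} (hf : ContDiff ℝ 1 f) {M : ℝ} (hM : ∀ x, ‖fderiv ℝ f x‖ ≤ M)

/-- The commutator of mollification at scale `ε` and differentiation along `V`. -/
noncomputable def commutator (ρ : E3 → ℝ) (V : E3 → E3) (f : E3 → ℝ) (a : E3) (ε : ℝ) (x : E3) :
    ℝ :=
  ∫ z, fderiv ℝ ρ z a * fderiv ℝ f (x - ε • z) (ε⁻¹ • (V (x - ε • z) - V x))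

include hL hM in
theorem commutator_integrand_le (a : E3) {ε : ℝ} (hε : 0 < ε) (x z : E3) :
    ‖fderiv ℝ ρ z a * fderiv ℝ f (x - ε • z) (ε⁻¹ • (V (x - ε • z) - V x))‖
      ≤ ‖fderiv ℝ ρ z a‖ * (M * (L * ‖z‖)) := by
  rw [norm_mul]
  refine mul_le_mul_of_nonneg_left ?_ (norm_nonneg _)
  refine (ContinuousLinearMap.le_opNorm _ _).trans ?_
  refine mul_le_mul (hM _) ?_ (norm_nonneg _) ((norm_nonneg _).trans (hM 0))
  rw [norm_smul, Real.norm_of_nonneg (by positivity)]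
  calc ε⁻¹ * ‖V (x - ε • z) - V x‖ ≤ ε⁻¹ * (L * ‖x - ε • z - x‖) := by gcongr; exact hL _ _
    _ = L * ‖z‖ := by
      rw [sub_sub_cancel_left, norm_neg, norm_smul, Real.norm_of_nonneg hε.le]
      field_simp

include hρ hρc in
theorem integrable_commutator_bound (a : E3) (C L : ℝ) :
    Integrable fun z => ‖fderiv ℝ ρ z a‖ * (C * (L * ‖z‖)) := by
  have h1 : Continuous fun z => fderiv ℝ ρ z a :=
    (hρ.continuous_fderiv two_ne_zero).clm_apply continuous_const
  exact (h1.norm.mul (by fun_prop)).integrable_of_hasCompactSupport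
    (hρc.fderiv_apply ℝ a).norm.mul_right

include hρ hρc hL hM in
theorem abs_commutator_le (a : E3) {ε : ℝ} (hε : 0 < ε) (x : E3) :
    |commutator ρ V f a ε x| ≤ ∫ z, ‖fderiv ℝ ρ z a‖ * (M * (L * ‖z‖)) :=
  norm_integral_le_of_norm_le (integrable_commutator_bound hρ hρc a M L)
    (Eventually.of_forall fun z => commutator_integrand_le hL hM a hε x z)

include hρ hV hf in
theorem continuous_commutator_integrand (a : E3) (ε : ℝ) (x : E3) :
    Continuous fun z =>
      fderiv ℝ ρ z a * fderiv ℝ f (x - ε • z) (ε⁻¹ • (V (x - ε • z) - V x)) := by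
  have h1 : Continuous fun z => fderiv ℝ ρ z a :=
    (hρ.continuous_fderiv two_ne_zero).clm_apply continuous_const
  have h2 := hf.continuous_fderiv one_ne_zero
  have h3 := hV.continuous
  have h4 : Continuous fun z : E3 => x - ε • z := by fun_prop
  have h5 : Continuous fun z => ε⁻¹ • (V (x - ε • z) - V x) := by fun_prop
  exact h1.mul ((h2.comp h4).clm_apply h5)

include hρ hρc hV hL hf hM in
-- The difference quotient of `V` tends to `-DV(x) z`, and the Lipschitz bound provides domination.
-- The limiting integrand is `∂_a ρ` times a linear function of `z`, so its integral is explicit.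
theorem tendsto_commutator (hρ1 : ∫ z, ρ z = 1) (a : E3) {ε : ℕ → ℝ} (hε : ∀ n, 0 < ε n)
    (hε0 : Tendsto ε atTop (𝓝 0)) (x : E3) :
    Tendsto (fun n => commutator ρ V f a (ε n) x) atTop
      (𝓝 (fderiv ℝ f x (fderiv ℝ V x a))) := by
  have e := integral_fderiv_mul_clm hρ hρc a (-(fderiv ℝ f x ∘L fderiv ℝ V x))
  rw [hρ1, mul_one] at e
  simp only [neg_apply, neg_neg, ContinuousLinearMap.comp_apply] at e
  rw [← e]
  refine tendsto_integral_of_dominated_convergence _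
    (fun n => (continuous_commutator_integrand hρ hV hf a (ε n) x).aestronglyMeasurable)
    (integrable_commutator_bound hρ hρc a M L)
    (fun n => Eventually.of_forall fun z => commutator_integrand_le hL hM a (hε n) x z)
    (Eventually.of_forall fun z => Tendsto.const_mul _ ?_)
  have t1 : Tendsto (fun n => x - ε n • z) atTop (𝓝 x) := by
    simpa using (hε0.smul_const z).const_sub x
  have t2 : Tendsto (fun n => fderiv ℝ f (x - ε n • z)) atTop (𝓝 (fderiv ℝ f x)) :=
    ((hf.continuous_fderiv one_ne_zero).tendsto x).comp t1
  have t3 : Tendsto (fun n => (ε n)⁻¹ • (V (x - ε n • z) - V x)) atTop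
      (𝓝 (-(fderiv ℝ V x z))) := by
    have h := (((hV.differentiable one_ne_zero x).hasFDerivAt.hasLineDerivAt
      (-z))).tendsto_slope_zero
    have hε' : Tendsto ε atTop (𝓝[≠] 0) :=
      tendsto_nhdsWithin_iff.2 ⟨hε0, Eventually.of_forall fun n => (hε n).ne'⟩
    simpa [← sub_eq_add_neg, Function.comp_def] using h.comp hε'
  have := (isBoundedBilinearMap_apply (𝕜 := ℝ) (E := E3) (F := ℝ)).continuous.tendsto
    (fderiv ℝ f x, -(fderiv ℝ V x z)) |>.comp (t2.prodMk_nhds t3)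
  simpa [Function.comp_def] using this

include hρ hρc hV hf in
-- The transport equation holds at `x - ε z` with `V (x - ε z)`, whereas differentiating the
-- mollification produces the frozen vector `V x`. The commutator is the cost of the exchange.
theorem inv_mul_integral_fderiv_mul_fderiv_apply {g : E3 → ℝ}
    (hg : ∀ y, fderiv ℝ f y (V y) = g y) (a : E3) {ε : ℝ} (x : E3) :
    ε⁻¹ * ∫ z, fderiv ℝ ρ z a * fderiv ℝ f (x - ε • z) (V x)
      = ε⁻¹ * (∫ z, fderiv ℝ ρ z a * g (x - ε • z)) - commutator ρ V f a ε x := by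
  have hgc : Continuous g := by
    rw [← funext hg]
    exact (hf.continuous_fderiv one_ne_zero).clm_apply hV.continuous
  have h1 : Continuous fun z => fderiv ℝ ρ z a :=
    (hρ.continuous_fderiv two_ne_zero).clm_apply continuous_const
  rw [commutator, ← integral_const_mul, ← integral_const_mul, ← integral_sub]
  · congr 1
    ext z
    rw [← hg]
    simp only [map_smul, map_sub, smul_eq_mul]
    ring
  · exact ((h1.mul (hgc.comp (by fun_prop))).integrable_of_hasCompactSupport
      (hρc.fderiv_apply ℝ a).mul_right).const_mul _
  · exact (continuous_commutator_integrand hρ hV hf a ε x).integrable_of_hasCompactSupport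
      (hρc.fderiv_apply ℝ a).mul_right

end Commutator

/-- Transport of an antisymmetrised gradient: if `f` and `g` solve the same transport equation
along `V` up to the derivatives of a potential `P` in the directions `c` and `a`, then `Df a - Dg c`
is transported without the potential. -/
theorem transportDeriv_sub {V : E3 → E3} (hV : ContDiff ℝ 1 V) {L : ℝ}
    (hL : ∀ x y, ‖V x - V y‖ ≤ L * ‖x - y‖) {f g P : E3 → ℝ} (hf : ContDiff ℝ 1 f)
    (hg : ContDiff ℝ 1 g) (hP : ContDiff ℝ 1 P) {M : ℝ} (hMf : ∀ x, ‖fderiv ℝ f x‖ ≤ M)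
    (hMg : ∀ x, ‖fderiv ℝ g x‖ ≤ M) {a c : E3} {κ : ℝ}
    (hfP : ∀ x, fderiv ℝ f x (V x) = -(κ * f x) - fderiv ℝ P x c)
    (hgP : ∀ x, fderiv ℝ g x (V x) = -(κ * g x) - fderiv ℝ P x a) :
    TransportDeriv V (fun x => fderiv ℝ f x a - fderiv ℝ g x c)
      (fun x => -(κ * (fderiv ℝ f x a - fderiv ℝ g x c)) - fderiv ℝ f x (fderiv ℝ V x a)
        + fderiv ℝ g x (fderiv ℝ V x c)) := by
  let β : ContDiffBump (0 : E3) := ⟨1, 2, one_pos, one_lt_two⟩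
  set ρ : E3 → ℝ := β.normed volume
  have hρ : ContDiff ℝ 2 ρ := β.contDiff_normed
  have hρc : HasCompactSupport ρ := β.hasCompactSupport_normed
  have hρ1 : ∫ z, ρ z = 1 := β.integral_normed
  have hdρ : ∀ v, Continuous fun z => fderiv ℝ ρ z v := fun v =>
    (hρ.continuous_fderiv two_ne_zero).clm_apply continuous_const
  have hdc : ∀ {h : E3 → ℝ}, ContDiff ℝ 1 h → ∀ v, Continuous fun z => fderiv ℝ h z v :=
    fun hh v => (hh.continuous_fderiv one_ne_zero).clm_apply continuous_const
  set w : E3 → ℝ := fun x => fderiv ℝ f x a - fderiv ℝ g x c with hw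
  have hwc : Continuous w := (hdc hf a).sub (hdc hg c)
  have hwM : ∀ x, |w x| ≤ M * ‖a‖ + M * ‖c‖ := by
    intro x
    refine (abs_sub _ _).trans (add_le_add ?_ ?_)
    · exact (ContinuousLinearMap.le_opNorm _ _).trans
        (mul_le_mul_of_nonneg_right (hMf x) (norm_nonneg _))
    · exact (ContinuousLinearMap.le_opNorm _ _).trans
        (mul_le_mul_of_nonneg_right (hMg x) (norm_nonneg _))
  have split : ∀ {h₁ h₂ : E3 → ℝ}, Continuous h₁ → Continuous h₂ → ∀ (v : E3) (ε : ℝ) (x : E3),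
      ∫ z, fderiv ℝ ρ z v * (h₁ (x - ε • z) - h₂ (x - ε • z))
        = (∫ z, fderiv ℝ ρ z v * h₁ (x - ε • z)) - ∫ z, fderiv ℝ ρ z v * h₂ (x - ε • z) := by
    intro h₁ h₂ c₁ c₂ v ε x
    simp only [mul_sub]
    exact integral_sub
      (((hdρ v).mul (c₁.comp (by fun_prop))).integrable_of_hasCompactSupport
        (hρc.fderiv_apply ℝ v).mul_right)
      (((hdρ v).mul (c₂.comp (by fun_prop))).integrable_of_hasCompactSupport
        (hρc.fderiv_apply ℝ v).mul_right)
  -- Exchange directions so that `f` and `g` are differentiated along `V x`, then insert their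
  -- equations. The pressure enters as `∂_a ∂_c P - ∂_c ∂_a P` in weak form and cancels.
  have formula : ∀ ε, 0 < ε → ∀ x, fderiv ℝ (moll ρ ε w) x (V x)
      = -(κ * moll ρ ε w x) - commutator ρ V f a ε x + commutator ρ V g c ε x := by
    intro ε hε x
    have hmw : moll ρ ε w x
        = moll ρ ε (fun y => fderiv ℝ f y a) x - moll ρ ε (fun y => fderiv ℝ g y c) x := by
      simp only [moll, hw, mul_sub]
      exact integral_sub
        ((hρ.continuous.mul ((hdc hf a).comp (by fun_prop))).integrable_of_hasCompactSupport
          hρc.mul_right)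
        ((hρ.continuous.mul ((hdc hg c).comp (by fun_prop))).integrable_of_hasCompactSupport
          hρc.mul_right)
    have one : ∀ {h : E3 → ℝ} {u v : E3}, ContDiff ℝ 1 h →
        (∀ x, fderiv ℝ h x (V x) = -(κ * h x) - fderiv ℝ P x v) →
        ε⁻¹ * ∫ z, fderiv ℝ ρ z (V x) * fderiv ℝ h (x - ε • z) u
          = -(κ * moll ρ ε (fun y => fderiv ℝ h y u) x)
            - ε⁻¹ * (∫ z, fderiv ℝ ρ z u * fderiv ℝ P (x - ε • z) v)
            - commutator ρ V h u ε x := by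
      intro h u v hh hhP
      rw [integral_fderiv_shift_comm hρ hρc hh hε,
        inv_mul_integral_fderiv_mul_fderiv_apply hρ hρc hV hh hhP,
        split (h₁ := fun y => -(κ * h y)) (continuous_const.mul hh.continuous).neg (hdc hP v),
        ← inv_mul_integral_fderiv_shift hρ hρc hh hε]
      have : ∫ z, fderiv ℝ ρ z u * -(κ * h (x - ε • z))
          = -κ * ∫ z, fderiv ℝ ρ z u * h (x - ε • z) := by
        rw [← integral_const_mul]
        congr 1
        ext z
        ring
      rw [this]
      ring
    rw [fderiv_moll hρ hρc hε hwc, split (hdc hf a) (hdc hg c), mul_sub, one hf hfP, one hg hgP,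
      hmw, integral_fderiv_shift_comm hρ hρc hP hε x a c]
    ring
  have ε0 : ∀ n : ℕ, (0 : ℝ) < 1 / ((n : ℝ) + 1) := fun n => by positivity
  have εt : Tendsto (fun n : ℕ => 1 / ((n : ℝ) + 1)) atTop (𝓝 0) :=
    tendsto_one_div_add_atTop_nhds_zero_nat
  set B₀ := (M * ‖a‖ + M * ‖c‖) * ∫ z, |ρ z|
  set Bf := ∫ z, ‖fderiv ℝ ρ z a‖ * (M * (L * ‖z‖))
  set Bg := ∫ z, ‖fderiv ℝ ρ z c‖ * (M * (L * ‖z‖))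
  refine ⟨max B₀ (|κ| * B₀ + Bf + Bg), fun n => moll ρ (1 / ((n : ℝ) + 1)) w,
    fun n => contDiff_moll hρ hρc (ε0 n) hwc,
    fun n x => (abs_moll_le hρ hρc hwM _ x).trans (le_max_left _ _), fun n x => ?_, fun x => ?_,
    fun x => ?_⟩
  · refine le_trans ?_ (le_max_right _ _)
    rw [formula _ (ε0 n)]
    refine (abs_add_le _ _).trans (add_le_add ((abs_sub _ _).trans (add_le_add ?_ ?_)) ?_)
    · rw [abs_neg, abs_mul]
      exact mul_le_mul_of_nonneg_left (abs_moll_le hρ hρc hwM _ x) (abs_nonneg _)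
    · exact abs_commutator_le hρ hρc hL hMf a (ε0 n) x
    · exact abs_commutator_le hρ hρc hL hMg c (ε0 n) x
  · simpa [hρ1] using tendsto_moll hρ hρc hwc hwM εt x
  · simp only [fun n : ℕ => formula _ (ε0 n) x]
    have t := tendsto_moll hρ hρc hwc hwM εt x
    rw [hρ1, one_mul] at t
    exact ((t.const_mul κ).neg.sub (tendsto_commutator hρ hρc hV hL hf hMf hρ1 a ε0 εt x)).add
      (tendsto_commutator hρ hρc hV hL hg hMg hρ1 c ε0 εt x)

/-! ### Radial averages and fields without curl and divergence -/

/-- A radial bump function. -/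
noncomputable def radialBump (z : E3) : ℝ := expNegInvGlue (1 - ‖z‖ ^ 2)

/-- The radial weight with `D radialBump z v = -2 ⟪z, v⟫ radialWeight z`. -/
noncomputable def radialWeight (z : E3) : ℝ := deriv expNegInvGlue (1 - ‖z‖ ^ 2)

theorem deriv_expNegInvGlue (t : ℝ) : deriv expNegInvGlue t = (t⁻¹) ^ 2 * expNegInvGlue t := by
  have h := expNegInvGlue.hasDerivAt_polynomial_eval_inv_mul 1 t
  simp only [Polynomial.eval_one, one_mul, Polynomial.derivative_one, sub_zero, mul_one,
    Polynomial.eval_pow, Polynomial.eval_X] at h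
  exact h.deriv

theorem contDiff_radialBump : ContDiff ℝ 2 radialBump :=
  expNegInvGlue.contDiff.comp (contDiff_const.sub (contDiff_norm_sq ℝ))

theorem contDiff_radialWeight : ContDiff ℝ 2 radialWeight := by
  have h : ContDiff ℝ 2 (deriv expNegInvGlue) :=
    ((contDiff_succ_iff_deriv (n := 2)).1 (expNegInvGlue.contDiff (n := 2 + 1))).2.2
  exact h.comp (contDiff_const.sub (contDiff_norm_sq ℝ))

theorem hasCompactSupport_radialBump : HasCompactSupport radialBump := by
  refine HasCompactSupport.intro (isCompact_closedBall (0 : E3) 1) fun z hz => ?_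
  refine expNegInvGlue.zero_of_nonpos ?_
  rw [mem_closedBall_zero_iff, not_le] at hz
  nlinarith

theorem hasCompactSupport_radialWeight : HasCompactSupport radialWeight := by
  refine HasCompactSupport.intro (isCompact_closedBall (0 : E3) 1) fun z hz => ?_
  rw [radialWeight, deriv_expNegInvGlue, expNegInvGlue.zero_of_nonpos, mul_zero]
  rw [mem_closedBall_zero_iff, not_le] at hz
  nlinarith

theorem integral_radialWeight_pos : 0 < ∫ z, radialWeight z := by
  refine contDiff_radialWeight.continuous.integral_pos_of_hasCompactSupport_nonneg_nonzero
    hasCompactSupport_radialWeight (fun z => ?_) (x := 0) ?_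
  · rw [radialWeight, deriv_expNegInvGlue]
    exact mul_nonneg (sq_nonneg _) (expNegInvGlue.nonneg _)
  · rw [radialWeight, deriv_expNegInvGlue]
    have := expNegInvGlue.pos_of_pos (x := 1 - ‖(0 : E3)‖ ^ 2) (by simp)
    simp only [norm_zero] at this ⊢
    norm_num at this ⊢

theorem fderiv_radialBump (z : E3) (k : Fin 3) :
    fderiv ℝ radialBump z (EuclideanSpace.single k 1) = -2 * (radialWeight z * z k) := by
  have h1 : HasFDerivAt (fun z : E3 => 1 - ‖z‖ ^ 2) (-(2 • innerSL ℝ z)) z :=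
    (hasStrictFDerivAt_norm_sq z).hasFDerivAt.const_sub 1
  have h2 : HasDerivAt expNegInvGlue (deriv expNegInvGlue (1 - ‖z‖ ^ 2)) (1 - ‖z‖ ^ 2) :=
    ((expNegInvGlue.contDiff (n := 1)).differentiable one_ne_zero _).hasDerivAt
  have h3 := (h2.comp_hasFDerivAt z h1).fderiv
  have h4 : radialBump = expNegInvGlue ∘ fun z : E3 => 1 - ‖z‖ ^ 2 := rfl
  rw [h4, h3, radialWeight]
  simp [EuclideanSpace.inner_single_right]
  ring

theorem hasDerivAt_moll {ρ : E3 → ℝ} (hρ : ContDiff ℝ 2 ρ) (hρc : HasCompactSupport ρ)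
    {f : E3 → ℝ} (hf : ContDiff ℝ 1 f) {M : ℝ} (hM : ∀ x, ‖fderiv ℝ f x‖ ≤ M) (x : E3) (t : ℝ) :
    HasDerivAt (fun s => moll ρ s f x) (∫ z, ρ z * -(fderiv ℝ f (x - t • z) z)) t := by
  have hc : ∀ s : ℝ, Continuous fun z => ρ z * f (x - s • z) := fun s =>
    hρ.continuous.mul (hf.continuous.comp (by fun_prop : Continuous fun z : E3 => x - s • z))
  have hfd := hf.continuous_fderiv one_ne_zero
  have hc' : Continuous fun z => ρ z * -(fderiv ℝ f (x - t • z) z) :=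
    hρ.continuous.mul ((hfd.comp (by fun_prop : Continuous fun z : E3 => x - t • z)).clm_apply
      continuous_id).neg
  refine (hasDerivAt_integral_of_dominated_loc_of_deriv_le (s := univ)
    (F := fun s z => ρ z * f (x - s • z)) (F' := fun s z => ρ z * -(fderiv ℝ f (x - s • z) z))
    (bound := fun z => |ρ z| * (M * ‖z‖)) univ_mem
    (Eventually.of_forall fun s => (hc s).aestronglyMeasurable)
    ((hc t).integrable_of_hasCompactSupport hρc.mul_right) hc'.aestronglyMeasurable
    (Eventually.of_forall fun z s _ => ?_)
    ((hρ.continuous.abs.mul (by fun_prop)).integrable_of_hasCompactSupport hρc.abs.mul_right)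
    (Eventually.of_forall fun z s _ => ?_)).2
  · rw [Real.norm_eq_abs, abs_mul, abs_neg]
    refine mul_le_mul_of_nonneg_left ?_ (abs_nonneg _)
    exact (ContinuousLinearMap.le_opNorm _ _).trans
      (mul_le_mul_of_nonneg_right (hM _) (norm_nonneg _))
  · have h1 : HasDerivAt (fun s : ℝ => x - s • z) (-z) s := by
      simpa using ((hasDerivAt_id s).smul_const z).const_sub x
    have h2 := (hf.differentiable one_ne_zero (x - s • z)).hasFDerivAt.comp_hasDerivAt s h1
    simpa using h2.const_mul (ρ z)

theorem partialDeriv_comm_of_curl_eq_zero {U : E3 → E3} {x : E3} (h : curl U x = 0)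
    (i j : Fin 3) : partialDeriv U i j x = partialDeriv U j i x := by
  have h0 := congrArg (fun v : E3 => v 0) h
  have h1 := congrArg (fun v : E3 => v 1) h
  have h2 := congrArg (fun v : E3 => v 2) h
  simp [curl] at h0 h1 h2
  fin_cases i <;> fin_cases j <;> simp <;> linarith

theorem tendsto_moll_atTop {ρ : E3 → ℝ} (hρ : ContDiff ℝ 2 ρ) (hρc : HasCompactSupport ρ)
    {f : E3 → ℝ} (hf : Continuous f) {B : ℝ} (hB : ∀ x, |f x| ≤ B)
    (h0 : Tendsto f (cocompact E3) (𝓝 0)) (x : E3) :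
    Tendsto (fun n : ℕ => moll ρ ((n : ℝ) + 1) f x) atTop (𝓝 0) := by
  rw [← integral_zero E3 ℝ (μ := volume)]
  refine tendsto_integral_of_dominated_convergence (fun z => |ρ z| * B) ?_
    ((hρ.continuous.abs.integrable_of_hasCompactSupport hρc.abs).mul_const B) ?_ ?_
  · exact fun n => (hρ.continuous.mul (hf.comp (by fun_prop))).aestronglyMeasurable
  · refine fun n => Eventually.of_forall fun z => ?_
    rw [Real.norm_eq_abs, abs_mul]
    exact mul_le_mul_of_nonneg_left (hB _) (abs_nonneg _)
  · have hne : ∀ᵐ z : E3, z ≠ 0 := by simp [ae_iff]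
    filter_upwards [hne] with z hz
    rw [← mul_zero (ρ z)]
    refine Tendsto.const_mul _ (h0.comp ?_)
    rw [← Metric.cobounded_eq_cocompact, ← comap_norm_atTop, tendsto_comap_iff]
    have h1 : Tendsto (fun n : ℕ => ((n : ℝ) + 1) * ‖z‖ - ‖x‖) atTop atTop :=
      tendsto_atTop_add_const_right _ _ ((tendsto_atTop_add_const_right _ _
        tendsto_natCast_atTop_atTop).atTop_mul_const (norm_pos_iff.2 hz))
    refine tendsto_atTop_mono (fun n => ?_) h1
    have h2 := norm_sub_norm_le (((n : ℝ) + 1) • z) x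
    rw [norm_smul, Real.norm_of_nonneg (by positivity)] at h2
    rw [Function.comp_apply, norm_sub_rev]
    exact h2

/-- A curl-free and divergence-free field vanishing at infinity is zero. -/
theorem eq_zero_of_curl_eq_zero {U : E3 → E3} (hU : ContDiff ℝ 1 U) {B M : ℝ}
    (hB : ∀ x, ‖U x‖ ≤ B) (hM : ∀ x, ‖fderiv ℝ U x‖ ≤ M)
    (h0 : Tendsto U (cocompact E3) (𝓝 0)) (hcurl : ∀ x, curl U x = 0)
    (hdiv : ∀ x, divergence U x = 0) : U = 0 := by
  have hUi := fun i => contDiff_coord hU i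
  have coord_le : ∀ (v : E3) i, |v i| ≤ ‖v‖ := fun v i => PiLp.norm_apply_le v i
  have hMi : ∀ i x, ‖fderiv ℝ (fun y => U y i) x‖ ≤ M := fun i x => by
    refine ContinuousLinearMap.opNorm_le_bound _ ((norm_nonneg _).trans (hM 0)) fun v => ?_
    rw [fderiv_coord hU, Real.norm_eq_abs]
    exact (coord_le _ _).trans ((ContinuousLinearMap.le_opNorm _ _).trans
      (mul_le_mul_of_nonneg_right (hM x) (norm_nonneg _)))
  have hBi : ∀ i x, |U x i| ≤ B := fun i x => (coord_le _ _).trans (hB x)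
  have h0i : ∀ i, Tendsto (fun x => U x i) (cocompact E3) (𝓝 0) := fun i =>
    ((coordL i).continuous.tendsto 0).comp h0 |>.trans_eq (by simp)
  -- Up to sign the scale derivative is the integral of `radialWeight z * (z·∇)U_j`. The symmetry
  -- `∂_k U_j = ∂_j U_k` and `z_k radialWeight = -∂_k radialBump / 2` turn it into a sum of terms
  -- `∂_k radialBump * ∂_j U_k`. Exchanging `k` and `j` leaves `∂_j radialBump * div U = 0`.
  have hder : ∀ j x t, 0 < t → HasDerivAt (fun s => moll radialWeight s (fun y => U y j) x) 0 t := by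
    intro j x t ht
    have h := hasDerivAt_moll contDiff_radialWeight hasCompactSupport_radialWeight (hUi j) (hMi j)
      x t
    have e : ∀ z, radialWeight z * -(fderiv ℝ (fun y => U y j) (x - t • z) z)
        = ∑ k, 1 / 2 * (fderiv ℝ radialBump z (EuclideanSpace.single k 1)
          * fderiv ℝ (fun y => U y k) (x - t • z) (EuclideanSpace.single j 1)) := by
      intro z
      rw [clm_apply_eq_sum (fderiv ℝ (fun y => U y j) (x - t • z)) z, ← Finset.sum_neg_distrib,
        Finset.mul_sum]
      refine Finset.sum_congr rfl fun k _ => ?_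
      have := partialDeriv_comm_of_curl_eq_zero (hcurl (x - t • z)) k j
      rw [partialDeriv, partialDeriv] at this
      rw [fderiv_coord hU, fderiv_coord hU, fderiv_radialBump, this, smul_eq_mul]
      ring
    have hint : ∀ a k, Integrable fun z => fderiv ℝ radialBump z a
        * fderiv ℝ (fun y => U y k) (x - t • z) (EuclideanSpace.single k 1) := fun a k =>
      (((contDiff_radialBump.continuous_fderiv two_ne_zero).clm_apply continuous_const).mul
        ((((hUi k).continuous_fderiv one_ne_zero).comp (by fun_prop)).clm_apply
        continuous_const)).integrable_of_hasCompactSupport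
        (hasCompactSupport_radialBump.fderiv_apply ℝ _).mul_right
    have hint' : ∀ k, Integrable fun z => fderiv ℝ radialBump z (EuclideanSpace.single k 1)
        * fderiv ℝ (fun y => U y k) (x - t • z) (EuclideanSpace.single j 1) := fun k =>
      (((contDiff_radialBump.continuous_fderiv two_ne_zero).clm_apply continuous_const).mul
        ((((hUi k).continuous_fderiv one_ne_zero).comp (by fun_prop)).clm_apply
        continuous_const)).integrable_of_hasCompactSupport
        (hasCompactSupport_radialBump.fderiv_apply ℝ _).mul_right
    have z0 : ∫ z, radialWeight z * -(fderiv ℝ (fun y => U y j) (x - t • z) z) = 0 := by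
      simp only [e]
      rw [integral_finsetSum _ fun k _ => (hint' k).const_mul _]
      simp only [integral_const_mul, integral_fderiv_shift_comm contDiff_radialBump
        hasCompactSupport_radialBump (hUi _) ht x (EuclideanSpace.single j 1)]
      rw [← Finset.mul_sum, ← integral_finsetSum _ fun k _ => hint _ k]
      have : ∀ z, ∑ k, fderiv ℝ radialBump z (EuclideanSpace.single j 1)
          * fderiv ℝ (fun y => U y k) (x - t • z) (EuclideanSpace.single k 1) = 0 := by
        intro z
        have hd := hdiv (x - t • z)
        simp only [divergence, partialDeriv] at hd
        simp only [fderiv_coord hU]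
        rw [← Finset.mul_sum, hd, mul_zero]
      simp [this]
    rwa [z0] at h
  ext x j
  have hconst : ∀ t, 0 < t → moll radialWeight t (fun y => U y j) x
      = moll radialWeight 1 (fun y => U y j) x := fun t ht =>
    isOpen_Ioi.is_const_of_deriv_eq_zero isPreconnected_Ioi
      (fun s hs => (hder j x s hs).differentiableAt.differentiableWithinAt)
      (fun s hs => (hder j x s hs).deriv) ht (mem_Ioi.2 one_pos)
  -- The constant average is compared at scales `1/(n+1)` and `n+1`.
  have l1 := tendsto_moll contDiff_radialWeight hasCompactSupport_radialWeight
    (hUi j).continuous (hBi j) tendsto_one_div_add_atTop_nhds_zero_nat x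
  have l2 := tendsto_moll_atTop contDiff_radialWeight hasCompactSupport_radialWeight
    (hUi j).continuous (hBi j) (h0i j) x
  simp only [fun n : ℕ => hconst (1 / ((n : ℝ) + 1)) (by positivity)] at l1
  simp only [fun n : ℕ => hconst ((n : ℝ) + 1) (by positivity)] at l2
  have h := tendsto_nhds_unique l1 l2
  simpa [integral_radialWeight_pos.ne'] using h

/-! ### Reduction to the profile equations -/

theorem IsC10.exists_bound {f : E3 → E3} (hf : IsC10 f) :
    ∃ B, 0 ≤ B ∧ (∀ x, ‖f x‖ ≤ B) ∧ ∀ x, ‖fderiv ℝ f x‖ ≤ B := by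
  have key : ∀ {F : Type} [NormedAddCommGroup F] (g : E3 → F), Continuous g →
      Tendsto g (cocompact E3) (𝓝 0) → ∃ C, ∀ x, ‖g x‖ ≤ C := by
    intro F _ g hg h0
    obtain ⟨C, hC⟩ := ZeroAtInftyContinuousMap.bounded (⟨⟨g, hg⟩, h0⟩ : ZeroAtInftyContinuousMap E3 F)
    refine ⟨C + ‖g 0‖, fun x => ?_⟩
    have h : dist (g x) (g 0) ≤ C := hC x 0
    rw [dist_eq_norm] at h
    linarith [norm_le_norm_sub_add (g x) (g 0)]
  obtain ⟨C, hC⟩ := key f hf.contDiff.continuous hf.tendsto_zero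
  obtain ⟨D, hD⟩ := key _ (hf.contDiff.continuous_fderiv one_ne_zero) hf.tendsto_fderiv_zero
  exact ⟨max C D, (norm_nonneg _).trans ((hC 0).trans (le_max_left _ _)),
    fun x => (hC x).trans (le_max_left _ _), fun x => (hD x).trans (le_max_right _ _)⟩

theorem fderiv_smul_comp_smul {F : Type*} [NormedAddCommGroup F] [NormedSpace ℝ F] {W : E3 → F}
    (hW : Differentiable ℝ W) (κ μ : ℝ) (x v : E3) :
    fderiv ℝ (fun x => κ • W (μ • x)) x v = (κ * μ) • fderiv ℝ W (μ • x) v := by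
  have h2 : HasFDerivAt (fun z : E3 => μ • z) (μ • ContinuousLinearMap.id ℝ E3) x :=
    (μ • ContinuousLinearMap.id ℝ E3).hasFDerivAt
  have h3 := ((hW (μ • x)).hasFDerivAt.comp x h2).const_smul κ
  have h4 : (fun x => κ • W (μ • x)) = κ • (W ∘ fun z : E3 => μ • z) := rfl
  rw [h4, h3.fderiv]
  simp [smul_smul]

theorem deriv_selfSimilar {W : E3 → E3} (hW : Differentiable ℝ W) {T t : ℝ} (ht : t < T) (x : E3) :
    deriv (fun s => (1 / √(T - s)) • W ((1 / √(T - s)) • x)) t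
      = ((1 / √(T - t)) ^ 3 / 2) • (W ((1 / √(T - t)) • x)
        + fderiv ℝ W ((1 / √(T - t)) • x) ((1 / √(T - t)) • x)) := by
  have hpos : 0 < T - t := sub_pos.2 ht
  have hs : 0 < √(T - t) := Real.sqrt_pos.2 hpos
  set μ := 1 / √(T - t) with hμ
  have h1 : HasDerivAt (fun s => 1 / √(T - s)) (μ ^ 3 / 2) t := by
    have h := (((hasDerivAt_id t).const_sub T).sqrt hpos.ne').inv hs.ne'
    simp only [id, ← one_div] at h
    refine h.congr_deriv ?_
    rw [hμ]
    field_simp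
  have h2 : HasDerivAt (fun s => W ((1 / √(T - s)) • x)) (fderiv ℝ W (μ • x) ((μ ^ 3 / 2) • x)) t :=
    (hW (μ • x)).hasFDerivAt.comp_hasDerivAt t (h1.smul_const x)
  rw [(h1.fun_smul h2).deriv, ← hμ, map_smul, map_smul, smul_smul, smul_add, smul_smul, add_comm]
  congr 2
  ring

/-- The stationary system satisfied by the profiles of a self-similar solution. -/
structure IsProfile (U : E3 → E3) (E : Fin 3 → E3 → E3) (P : E3 → ℝ) : Prop where
  differentiable_P : Differentiable ℝ P
  momentum : ∀ y, (1 / 2 : ℝ) • (U y + fderiv ℝ U y y) + fderiv ℝ U y (U y)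
    = -gradient P y + ∑ k, fderiv ℝ (E k) y (E k y)
  deformation : ∀ k y, (1 / 2 : ℝ) • (E k y + fderiv ℝ (E k) y y) + fderiv ℝ (E k) y (U y)
    = fderiv ℝ U y (E k y)
  div_U : ∀ y, divergence U y = 0

/-- A single time suffices. With `μ = 1/√(T - t)`, evaluated at `x = μ⁻¹ y`, every term of the two
evolution equations carries the same factor `μ³`, and the divergence carries `μ²`. -/
theorem isProfile_of_isSelfSimilar {T : ℝ} (hT : 0 < T) {u : ℝ → E3 → E3}
    {F : Fin 3 → ℝ → E3 → E3} {p : ℝ → E3 → ℝ} {U : E3 → E3} {E : Fin 3 → E3 → E3} {P : E3 → ℝ}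
    (hsol : IsClassicalSolution T u F p) (hself : IsSelfSimilar T u F p U E P)
    (hU : Differentiable ℝ U) (hE : ∀ k, Differentiable ℝ (E k)) : IsProfile U E P := by
  obtain ⟨t, ht0, htT⟩ : ∃ t, 0 < t ∧ t < T := exists_between hT
  have ht : t ∈ Ioo 0 T := ⟨ht0, htT⟩
  have hnhds : ∀ᶠ s in 𝓝 t, s ∈ Ioo 0 T := isOpen_Ioo.mem_nhds ht
  have hpos : 0 < T - t := sub_pos.2 htT
  have hs : 0 < √(T - t) := Real.sqrt_pos.2 hpos
  have hut : u t = fun x => (1 / √(T - t)) • U ((1 / √(T - t)) • x) :=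
    funext (hself.velocity t ht)
  have hFt : ∀ k, F k t = fun x => (1 / √(T - t)) • E k ((1 / √(T - t)) • x) := fun k =>
    funext (hself.deformation k t ht)
  have hpt : p t = fun x => (1 / (T - t)) • P ((1 / √(T - t)) • x) :=
    funext (hself.pressure t ht)
  have hut' : ∀ x, deriv (fun s => u s x) t
      = ((1 / √(T - t)) ^ 3 / 2) • (U ((1 / √(T - t)) • x)
        + fderiv ℝ U ((1 / √(T - t)) • x) ((1 / √(T - t)) • x)) := fun x => by
    rw [← deriv_selfSimilar hU htT]
    exact EventuallyEq.deriv_eq (hnhds.mono fun s hs => hself.velocity s hs x)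
  have hFt' : ∀ k x, deriv (fun s => F k s x) t
      = ((1 / √(T - t)) ^ 3 / 2) • (E k ((1 / √(T - t)) • x)
        + fderiv ℝ (E k) ((1 / √(T - t)) • x) ((1 / √(T - t)) • x)) := fun k x => by
    rw [← deriv_selfSimilar (hE k) htT]
    exact EventuallyEq.deriv_eq (hnhds.mono fun s hs => hself.deformation k s hs x)
  have hμ2 : 1 / (T - t) = (1 / √(T - t)) ^ 2 := by
    rw [div_pow, Real.sq_sqrt hpos.le, one_pow]
  rw [hμ2] at hpt
  set μ := 1 / √(T - t) with hμ
  have hμ0 : 0 < μ := by positivity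
  -- Undoing the scaling expresses `P` through `p t`, which is differentiable.
  have hP : Differentiable ℝ P := by
    have h1 : P = fun y => (μ ^ 2)⁻¹ * p t (μ⁻¹ • y) := by
      ext y
      rw [hpt]
      simp only [smul_smul, mul_inv_cancel₀ hμ0.ne', one_smul, smul_eq_mul]
      rw [← mul_assoc, inv_mul_cancel₀ (by positivity), one_mul]
    rw [h1]
    exact ((hsol.differentiable_p t ht).comp
      (μ⁻¹ • ContinuousLinearMap.id ℝ E3).differentiable).const_mul _
  have adv : ∀ {A B : E3 → E3}, Differentiable ℝ B → ∀ y,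
      advect (fun x => μ • A (μ • x)) (fun x => μ • B (μ • x)) (μ⁻¹ • y)
        = μ ^ 3 • fderiv ℝ B y (A y) := by
    intro A B hB y
    rw [advect, fderiv_smul_comp_smul hB]
    simp only [smul_smul, mul_inv_cancel₀ hμ0.ne', one_smul, map_smul]
    congr 1
    ring
  have grad : ∀ y, gradient (p t) (μ⁻¹ • y) = μ ^ 3 • gradient P y := by
    intro y
    refine ext_inner_right ℝ fun v => ?_
    rw [inner_gradient_left, inner_smul_left, inner_gradient_left, hpt, fderiv_smul_comp_smul hP]
    simp only [smul_smul, mul_inv_cancel₀ hμ0.ne', one_smul, smul_eq_mul, conj_trivial]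
    ring
  have half : ∀ v : E3, (μ ^ 3 / 2) • v = μ ^ 3 • ((1 / 2 : ℝ) • v) := fun v => by
    rw [smul_smul]
    congr 1
    ring
  refine ⟨hP, fun y => ?_, fun k y => ?_, fun y => ?_⟩
  · have h := hsol.momentum t ht (μ⁻¹ • y)
    rw [hut', grad] at h
    simp only [hut, hFt, adv hU, fun k => adv (A := E k) (hE k), smul_smul,
      mul_inv_cancel₀ hμ0.ne', one_smul] at h
    rw [half, ← Finset.smul_sum, ← smul_neg, ← smul_add, ← smul_add] at h
    exact smul_right_injective E3 (pow_ne_zero 3 hμ0.ne') h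
  · have h := hsol.deformation k t ht (μ⁻¹ • y)
    rw [hFt'] at h
    simp only [hut, hFt, adv hU, adv (hE k), smul_smul, mul_inv_cancel₀ hμ0.ne', one_smul] at h
    rw [half, ← smul_add] at h
    exact smul_right_injective E3 (pow_ne_zero 3 hμ0.ne') h
  · have h := hsol.div_u t ht (μ⁻¹ • y)
    simp only [divergence, partialDeriv, hut, fderiv_smul_comp_smul hU, smul_smul,
      mul_inv_cancel₀ hμ0.ne', one_smul, PiLp.smul_apply, smul_eq_mul] at h
    rw [← Finset.mul_sum] at h
    exact (mul_eq_zero.1 h).resolve_left (by positivity)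

/-! ### The similarity field and the vanishing of deformation and vorticity -/

/-- The velocity in self-similar variables. -/
noncomputable def similarityField (U : E3 → E3) (y : E3) : E3 := (1 / 2 : ℝ) • y + U y

section SimilarityField

variable {U : E3 → E3} (hU : ContDiff ℝ 1 U)

include hU

theorem contDiff_similarityField : ContDiff ℝ 1 (similarityField U) :=
  (contDiff_const_smul _).add hU

theorem fderiv_similarityField (x v : E3) :
    fderiv ℝ (similarityField U) x v = (1 / 2 : ℝ) • v + fderiv ℝ U x v := by
  have h : HasFDerivAt (similarityField U)
      ((1 / 2 : ℝ) • ContinuousLinearMap.id ℝ E3 + fderiv ℝ U x) x :=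
    ((1 / 2 : ℝ) • ContinuousLinearMap.id ℝ E3).hasFDerivAt.add
      (hU.differentiable one_ne_zero x).hasFDerivAt
  rw [h.fderiv]
  simp

theorem divergence_similarityField (hdiv : ∀ x, divergence U x = 0) (x : E3) :
    divergence (similarityField U) x = 3 / 2 := by
  have h := hdiv x
  simp only [divergence, partialDeriv, Fin.sum_univ_three] at h
  simp only [divergence, partialDeriv, fderiv_similarityField hU, Fin.sum_univ_three,
    PiLp.add_apply, PiLp.smul_apply, smul_eq_mul, PiLp.single_apply, if_true]
  linarith

theorem norm_similarityField_sub_le {M : ℝ} (hM : ∀ x, ‖fderiv ℝ U x‖ ≤ M) (x y : E3) :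
    ‖similarityField U x - similarityField U y‖ ≤ (1 / 2 + M) * ‖x - y‖ := by
  refine convex_univ.norm_image_sub_le_of_norm_fderiv_le (𝕜 := ℝ)
    (fun z _ => (contDiff_similarityField hU).differentiable one_ne_zero z) (fun z _ => ?_)
    (mem_univ y) (mem_univ x)
  refine ContinuousLinearMap.opNorm_le_bound _ (by linarith [(norm_nonneg _).trans (hM 0)])
    fun v => ?_
  rw [fderiv_similarityField hU, add_mul]
  refine (norm_add_le _ _).trans (add_le_add ?_ ?_)
  · rw [norm_smul]
    norm_num
  · exact (ContinuousLinearMap.le_opNorm _ _).trans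
      (mul_le_mul_of_nonneg_right (hM z) (norm_nonneg _))

end SimilarityField

theorem norm_similarityField_le {U : E3 → E3} {B : ℝ} (hB : ∀ x, ‖U x‖ ≤ B) (x : E3) :
    ‖similarityField U x‖ ≤ ‖x‖ + B := by
  refine (norm_add_le _ _).trans (add_le_add ?_ (hB x))
  rw [norm_smul]
  norm_num
  linarith [norm_nonneg x]

/-- A field with small powers integrable which is transported by the similarity field with a
source term dominated by the field vanishes. -/
theorem eq_zero_of_transportDeriv_similarityField {U : E3 → E3} (hU : ContDiff ℝ 1 U) {B : ℝ}
    (hB : ∀ x, ‖U x‖ ≤ B) (hdiv : ∀ x, divergence U x = 0) {W b : E3 → E3} (hW : Continuous W)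
    (hb : Continuous b)
    (hWb : ∀ i, TransportDeriv (similarityField U) (fun x => W x i) (fun x => b x i)) {C : ℝ}
    (hC : 0 ≤ C) (hle : ∀ x, ‖b x‖ ≤ C * ‖W x‖)
    (hint : ∃ q : ℝ, 0 < q ∧ ∀ r : ℝ, 0 < r → r < q → MemLp W (ENNReal.ofReal r) volume) :
    W = 0 := by
  obtain ⟨q, hq, hint⟩ := hint
  have h := eq_zero_of_transportDeriv (contDiff_similarityField hU)
    (divergence_similarityField hU hdiv) (norm_similarityField_le hB)
    (w := fun i x => W x i) (b := fun i x => b x i)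
    (fun i => (coordL i).continuous.comp hW) (fun i => (coordL i).continuous.comp hb) hWb hC
    (fun x => ?_) (half_pos hq) (fun a ha haq => ?_)
  · ext x i
    exact congrFun (h i) x
  · have e : ∑ i, W x i * b x i = inner ℝ (W x) (b x) := by
      rw [PiLp.inner_apply]
      exact Finset.sum_congr rfl fun i _ => by simp [mul_comm]
    rw [e, ← EuclideanSpace.real_norm_sq_eq]
    calc |inner ℝ (W x) (b x)| ≤ ‖W x‖ * ‖b x‖ := abs_real_inner_le_norm _ _
      _ ≤ ‖W x‖ * (C * ‖W x‖) := by gcongr; exact hle x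
      _ = C * ‖W x‖ ^ 2 := by ring
  -- Here `(∑ W_i²)^a = ‖W‖^(2a)`, which is why the threshold passed on is `q/2`.
  · have hm := (hint (2 * a) (by linarith) (by linarith)).integrable_norm_rpow
      (by simpa using ha) ENNReal.ofReal_ne_top
    rw [ENNReal.toReal_ofReal (by linarith)] at hm
    refine hm.congr (Eventually.of_forall fun x => ?_)
    simp only
    rw [← EuclideanSpace.real_norm_sq_eq, Real.rpow_mul (norm_nonneg _), Real.rpow_two]

/-- `E k` is `C¹`, so its transport equation is classical. Its source `(E k·∇)U - E k/2` is at most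
`(B + 1/2)‖E k‖`, where `B` bounds the gradient of `U`. -/
theorem IsProfile.deformation_eq_zero {U : E3 → E3} {E : Fin 3 → E3 → E3} {P : E3 → ℝ}
    (h : IsProfile U E P) (hU : IsC10 U) (k : Fin 3) (hE : IsC10 (E k))
    (hint : ∃ q : ℝ, 0 < q ∧ ∀ r : ℝ, 0 < r → r < q → MemLp (E k) (ENNReal.ofReal r) volume) :
    E k = 0 := by
  obtain ⟨B, hB0, hB, hM⟩ := hU.exists_bound
  obtain ⟨B', hB'0, hB', -⟩ := hE.exists_bound
  have hV := contDiff_similarityField hU.contDiff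
  have eqn : ∀ x, fderiv ℝ (E k) x (similarityField U x)
      = fderiv ℝ U x (E k x) - (1 / 2 : ℝ) • E k x := fun x => by
    rw [← h.deformation, similarityField, map_add, map_smul]
    module
  have hle : ∀ x, ‖fderiv ℝ (E k) x (similarityField U x)‖ ≤ (B + 1 / 2) * ‖E k x‖ := fun x => by
    rw [eqn, add_mul]
    refine (norm_sub_le _ _).trans (add_le_add ?_ ?_)
    · exact (ContinuousLinearMap.le_opNorm _ _).trans
        (mul_le_mul_of_nonneg_right (hM x) (norm_nonneg _))
    · rw [norm_smul]
      norm_num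
  refine eq_zero_of_transportDeriv_similarityField hU.contDiff hB h.div_U
    hE.contDiff.continuous ((hE.contDiff.continuous_fderiv one_ne_zero).clm_apply hV.continuous)
    (fun i => ?_) (by positivity) hle hint
  have hd : ∀ x, fderiv ℝ (fun y => E k y i) x (similarityField U x)
      = fderiv ℝ (E k) x (similarityField U x) i := fun x => fderiv_coord hE.contDiff i x _
  have := TransportDeriv.of_contDiff (V := similarityField U) (contDiff_coord hE.contDiff i)
    (C := B') (D := (B + 1 / 2) * B') (fun x => (PiLp.norm_apply_le (E k x) i).trans (hB' x))
    (fun x => ?_)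
  · simpa only [hd] using this
  · rw [hd]
    exact (PiLp.norm_apply_le (fderiv ℝ (E k) x (similarityField U x)) i).trans ((hle x).trans
      (mul_le_mul_of_nonneg_left (hB' x) (by positivity)))

/-- Each component of the curl is an antisymmetrised gradient of two components of `U`, whose
equations share the potential `P`. The damping `1/2` doubles to `1`, the other half coming from the
dilation in `DV`. -/
theorem transportDeriv_curl {U : E3 → E3} (hU : ContDiff ℝ 1 U) {M : ℝ}
    (hM : ∀ x, ‖fderiv ℝ U x‖ ≤ M) (hdiv : ∀ x, divergence U x = 0) {P : E3 → ℝ}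
    (hP : ContDiff ℝ 1 P)
    (heq : ∀ x, fderiv ℝ U x (similarityField U x) = -((1 / 2 : ℝ) • U x) - gradient P x)
    (i : Fin 3) :
    TransportDeriv (similarityField U) (fun x => curl U x i)
      (fun x => (fderiv ℝ U x (curl U x) - curl U x) i) := by
  have hMi : ∀ i x, ‖fderiv ℝ (fun y => U y i) x‖ ≤ M := fun i x => by
    refine ContinuousLinearMap.opNorm_le_bound _ ((norm_nonneg _).trans (hM 0)) fun v => ?_
    rw [fderiv_coord hU]
    exact (PiLp.norm_apply_le (fderiv ℝ U x v) i).trans ((ContinuousLinearMap.le_opNorm _ _).trans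
      (mul_le_mul_of_nonneg_right (hM x) (norm_nonneg _)))
  have heqi : ∀ i x, fderiv ℝ (fun y => U y i) x (similarityField U x)
      = -(1 / 2 * U x i) - fderiv ℝ P x (EuclideanSpace.single i 1) := fun i x => by
    have hg : gradient P x i = fderiv ℝ P x (EuclideanSpace.single i 1) := by
      rw [← inner_gradient_left, EuclideanSpace.inner_single_right]
      simp
    rw [fderiv_coord hU, heq, ← hg]
    simp
  have hT := fun m n => transportDeriv_sub (contDiff_similarityField hU)
    (norm_similarityField_sub_le hU hM) (contDiff_coord hU m) (contDiff_coord hU n) hP (hMi m)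
    (hMi n) (heqi m) (heqi n)
  have hexp : ∀ x (v : E3) j, fderiv ℝ U x v j = ∑ k, v k * partialDeriv U k j x := fun x v j => by
    rw [clm_apply_eq_sum (fderiv ℝ U x) v]
    simp [partialDeriv]
  have hp : ∀ x k j, fderiv ℝ U x (EuclideanSpace.single k 1) j = partialDeriv U k j x :=
    fun _ _ _ => rfl
  have hd : ∀ x, partialDeriv U 0 0 x + partialDeriv U 1 1 x + partialDeriv U 2 2 x = 0 := fun x => by
    simpa [divergence, Fin.sum_univ_three] using hdiv x
  simp only [fderiv_coord hU, fderiv_similarityField hU, map_add, map_smul, PiLp.add_apply,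
    PiLp.smul_apply, smul_eq_mul, hexp _ (fderiv ℝ U _ _), hp, Fin.sum_univ_three] at hT
  simp only [PiLp.sub_apply, hexp, Fin.sum_univ_three]
  fin_cases i
  · convert hT 2 1 using 2 with x x
    · simp [curl]
    · simp [curl]
      -- Incompressibility turns the antisymmetrised quadratic terms into the vortex stretching
      -- `(Ω·∇)U`.
      linear_combination (partialDeriv U 1 2 x - partialDeriv U 2 1 x) * hd x
  · convert hT 0 2 using 2 with x x
    · simp [curl]
    · simp [curl]
      linear_combination (partialDeriv U 2 0 x - partialDeriv U 0 2 x) * hd x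
  · convert hT 1 0 using 2 with x x
    · simp [curl]
    · simp [curl]
      linear_combination (partialDeriv U 0 1 x - partialDeriv U 1 0 x) * hd x

theorem continuous_curl {U : E3 → E3} (hU : ContDiff ℝ 1 U) : Continuous (curl U) := by
  have h : ∀ j i, Continuous (partialDeriv U j i) := fun j i =>
    (coordL i).continuous.comp ((hU.continuous_fderiv one_ne_zero).clm_apply continuous_const)
  refine (PiLp.continuous_toLp 2 _).comp (continuous_pi fun i => ?_)
  fin_cases i
  · exact (h 1 2).sub (h 2 1)
  · exact (h 2 0).sub (h 0 2)
  · exact (h 0 1).sub (h 1 0)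

theorem IsProfile.curl_eq_zero {U : E3 → E3} {P : E3 → ℝ} (h : IsProfile U 0 P) (hU : IsC10 U)
    (hint : ∃ q : ℝ, 0 < q ∧ ∀ r : ℝ, 0 < r → r < q →
      MemLp (curl U) (ENNReal.ofReal r) volume) : curl U = 0 := by
  obtain ⟨B, hB0, hB, hM⟩ := hU.exists_bound
  have hV := contDiff_similarityField hU.contDiff
  have hdc := hU.contDiff.continuous_fderiv one_ne_zero
  have heq : ∀ x, fderiv ℝ U x (similarityField U x) = -((1 / 2 : ℝ) • U x) - gradient P x := by
    intro x
    have h1 := h.momentum x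
    simp only [Pi.zero_apply, map_zero, Finset.sum_const_zero, add_zero] at h1
    rw [← neg_eq_iff_eq_neg.2 h1, similarityField, map_add, map_smul]
    module
  -- `P` is only known to be differentiable; the momentum equation writes its gradient through
  -- continuous quantities.
  have hP : ContDiff ℝ 1 P := by
    refine contDiff_one_iff_fderiv.2 ⟨h.differentiable_P, continuous_clm_apply.2 fun v => ?_⟩
    have hg : Continuous (gradient P) := by
      have : gradient P = fun x => -((1 / 2 : ℝ) • U x) - fderiv ℝ U x (similarityField U x) := by
        ext1 x
        rw [heq]
        abel
      rw [this]
      exact (hU.contDiff.continuous.const_smul (1 / 2 : ℝ)).neg.sub (hdc.clm_apply hV.continuous)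
    simp only [← inner_gradient_left]
    exact hg.inner continuous_const
  have hc := continuous_curl hU.contDiff
  refine eq_zero_of_transportDeriv_similarityField hU.contDiff hB h.div_U hc
    ((hdc.clm_apply hc).sub hc) (transportDeriv_curl hU.contDiff hM h.div_U hP heq)
    (C := B + 1) (by positivity) (fun x => ?_) hint
  rw [add_mul, one_mul]
  exact (norm_sub_le _ _).trans (add_le_add_left ((ContinuousLinearMap.le_opNorm _ _).trans
    (mul_le_mul_of_nonneg_right (hM x) (norm_nonneg _))) _)

end Viscoelastic

theorem theorem1p1
    (T : ℝ) (hT : 0 < T)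
    (u : ℝ → Viscoelastic.E3 → Viscoelastic.E3)
    (F : Fin 3 → ℝ → Viscoelastic.E3 → Viscoelastic.E3)
    (p : ℝ → Viscoelastic.E3 → ℝ)
    (U : Viscoelastic.E3 → Viscoelastic.E3)
    (E : Fin 3 → Viscoelastic.E3 → Viscoelastic.E3)
    (P : Viscoelastic.E3 → ℝ)
    (hsol : Viscoelastic.IsClassicalSolution T u F p)
    (hself : Viscoelastic.IsSelfSimilar T u F p U E P)
    (hU : Viscoelastic.IsC10 U) (hE : ∀ k, Viscoelastic.IsC10 (E k))
    (hint : ∃ q : ℝ, 0 < q ∧ ∀ r : ℝ, 0 < r → r < q →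
      MemLp (Viscoelastic.curl U) (ENNReal.ofReal r) volume ∧
      ∀ k, MemLp (E k) (ENNReal.ofReal r) volume) :
    U = 0 ∧ E = 0 := by
  obtain ⟨q, hq, hint⟩ := hint
  have hprof := Viscoelastic.isProfile_of_isSelfSimilar hT hsol hself
    (hU.contDiff.differentiable one_ne_zero) fun k => (hE k).contDiff.differentiable one_ne_zero
  have hE0 : E = 0 := funext fun k =>
    hprof.deformation_eq_zero hU k (hE k) ⟨q, hq, fun r h0 h1 => (hint r h0 h1).2 k⟩
  rw [hE0] at hprof
  have hcurl := hprof.curl_eq_zero hU ⟨q, hq, fun r h0 h1 => (hint r h0 h1).1⟩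
  obtain ⟨B, -, hB, hM⟩ := hU.exists_bound
  exact ⟨Viscoelastic.eq_zero_of_curl_eq_zero hU.contDiff hB hM hU.tendsto_zero
    (congrFun hcurl) hprof.div_U, hE0⟩
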